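/- Let $d\ge 1$ be an integer and let $J:\mathbb Z^d\times\mathbb Z^d\to[0,\infty)$ be a kernel that is symmetric ($J(x,y)=J(y,x)$), translation invariant ($J(x,y)=J(0,y-x)$) and integrable ($\sum_{x\in\mathbb Z^d}J(0,x)<\infty$). For $\beta\ge 0$ let $\mathbb P_\beta$ be the law of Bernoulli bond percolation on $\mathbb Z^d$ in which each edge $\{x,y\}$ with $x\ne y$ is open with probability $1-e^{-\beta J(x,y)}$, independently of all other edges. Let $K_0$ be the open cluster of the origin, i.e. the set of vertices joined to $0$ by a path of open edges, and let $$\beta_c=\inf\{\beta\ge 0:\ \mathbb P_\beta(|K_0|=\infty)>0\}\in[0,\infty],\qquad \inf\emptyset=\infty .$$ Let $\alpha\in(0,1)$ if $d=1$, and $\alpha>0$ if $d>1$, and assume that there is a constant $C_1<\infty$ such that $J(x,y)\le C_1\|x-y\|^{-d-\alpha}$ for all $x\neq y$ in $\mathbb Z^d$, where $\|\cdot\|$ is the Euclidean norm. Suppose that $\beta_c<\infty$ and that for some $\delta>0$ and some constant $C<\infty$ $$\sum_{k=1}^n \mathbb P_{\beta_c}(|K_0|\ge k)\ \le\ C\,n^{1-1/\delta}\qquad\text{for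 all integers } n\ge 1 .$$ Then $$\delta\ \ge\ \frac{d+(\alpha\wedge 1)}{d-(\alpha\wedge 1)},$$ where $\alpha\wedge 1=\min\{\alpha,1\}$. -/

import Mathlib

open MeasureTheory
open scoped ENNReal NNReal

namespace LongRange

/-- A percolation kernel on `ℤ^d`: nonnegative, symmetric, translation invariant, integrable. -/
structure Kernel (d : ℕ) where
  /-- the weight `J(x,y)` -/
  J : (Fin d → ℤ) → (Fin d → ℤ) → ℝ≥0
  symm : ∀ x y, J x y = J y x
  translation_invariant : ∀ x y, J x y = J 0 (y - x)
  integrable : Summable fun x => J 0 x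

/-- The Euclidean norm of a point of `ℤ^d`. -/
noncomputable def euclideanNorm {d : ℕ} (x : Fin d → ℤ) : ℝ :=
  Real.sqrt (∑ i, (x i : ℝ) ^ 2)

/-- The weight of the unordered pair `{x,y}`. -/
def Kernel.weight {d : ℕ} (K : Kernel d) : Sym2 (Fin d → ℤ) → ℝ≥0 :=
  Sym2.lift ⟨K.J, K.symm⟩

/-- The probability `1 - exp(-β J(x,y))` that the edge `{x,y}` is open. -/
noncomputable def Kernel.edgeProb {d : ℕ} (K : Kernel d) (β : ℝ≥0) (e : Sym2 (Fin d → ℤ)) :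
    unitInterval :=
  ⟨1 - Real.exp (-((β : ℝ) * (K.weight e : ℝ))),
    sub_nonneg.2 (Real.exp_le_one_iff.2 (neg_nonpos.2 (by positivity))),
    sub_le_self _ (Real.exp_pos _).le⟩

/-- A configuration records which edges are open (`true`). Loops are included among the
coordinates for convenience; they are ignored when the open graph is formed. -/
abbrev Config (d : ℕ) : Type := Sym2 (Fin d → ℤ) → Bool

/-- The Bernoulli percolation measure `P_β`: edges are open independently of each other. -/
noncomputable def Kernel.percolation {d : ℕ} (K : Kernel d) (β : ℝ≥0) : Measure (Config d) :=
  Measure.infinitePi fun e => ProbabilityTheory.bernoulliMeasure true false (K.edgeProb β e)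

/-- The random graph on `ℤ^d` formed by the open edges. -/
def openGraph {d : ℕ} (ω : Config d) : SimpleGraph (Fin d → ℤ) :=
  SimpleGraph.fromEdgeSet {e | ω e = true}

/-- The open cluster `K_x` of the vertex `x`. -/
def cluster {d : ℕ} (ω : Config d) (x : Fin d → ℤ) : Set (Fin d → ℤ) :=
  {y | (openGraph ω).Reachable x y}

/-- The probability `P_β(|K_0| ≥ k)`. -/
noncomputable def Kernel.clusterTail {d : ℕ} (K : Kernel d) (β : ℝ≥0) (k : ℕ) : ℝ :=
  (K.percolation β).real {ω | (k : ℕ∞) ≤ (cluster ω 0).encard}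

/-- The critical parameter `β_c = inf {β ≥ 0 : P_β(|K_0| = ∞) > 0}`, equal to `∞` if there is
no such `β`. -/
noncomputable def Kernel.criticalParameter {d : ℕ} (K : Kernel d) : ℝ≥0∞ :=
  sInf {b : ℝ≥0∞ | ∃ β : ℝ≥0, b = β ∧ 0 < K.percolation β {ω | (cluster ω 0).encard = ⊤}}

end LongRange

/-!
The proof compares two estimates for the clusters inside the box `Λ = {0, …, r - 1}^d` at the
critical point.

*Lower bound.* Let `φ(S, o)` be `β` times the expected weight of the edges that leave a finite set
`S ∋ o` from the cluster of `o` in `S` (`Kernel.boundaryFlux`). If `φ(S, o) < 1`, then splitting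
paths at their first exit from a translate of `S` and applying the van den Berg–Kesten inequality
bounds the expected size of clusters in every finite domain (`Kernel.sum_prob_joined_le`), so there
is no infinite cluster. As `φ` is continuous in `β`, this gives `φ(S, o) ≥ 1` at `β_c`
(`Kernel.one_le_boundaryFlux`). Summing over `o ∈ S = Λ` yields
`r ^ d ≤ β_c · max_x E|K_x^Λ| · ∑_{x ∈ Λ, y ∉ Λ} J(x, y)`, where `K_x^Λ` is the cluster of `x` in
`Λ`. The last sum is `O(r ^ (d - θ))` for every `θ < α ∧ 1` (`Kernel.exists_sum_outWeight_box_le`).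

*Upper bound.* Let `a(n)` be the probability that some cluster in `Λ` has at least `n` vertices. All
vertices of such a cluster have a large cluster, so `n a(n) ≤ r ^ d P(|K_0| ≥ n)`. The assumed decay
makes `a(n) = O(r ^ (-η'))` for some `η' > 0` as soon as `n` is of order `r ^ κ`, where `κ` is
slightly larger than `d δ / (δ + 1)`. A connected set with `3 n` vertices contains two edge-disjoint
connected pieces with `n` vertices each (`CutConnected.exists_split`), so `a(3 n) ≤ a(n) ^ 2` by the
van den Berg–Kesten inequality; after boundedly many steps the probability is `O(r ^ (-d))`.
Truncating the cluster size at this level gives `E|K_x^Λ| = O(r ^ (κ (1 - 1 / δ)))`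
(`Kernel.exists_sum_prob_joined_box_le`).

Together, `θ ≤ κ (1 - 1 / δ)`. Letting `κ → d δ / (δ + 1)` and `θ → α ∧ 1` gives
`(α ∧ 1) (δ + 1) ≤ d (δ - 1)`, which is the claim.
-/

namespace LongRange

/-! ### Bernoulli percolation on finitely many edges and the BK inequality -/

section BK

variable {ι : Type*}

/-- The Bernoulli product measure with edge probabilities `p`. -/
noncomputable def bernoulliProduct (p : ι → unitInterval) : Measure (ι → Bool) :=
  Measure.infinitePi fun e => ProbabilityTheory.bernoulliMeasure true false (p e)

instance (p : ι → unitInterval) : IsProbabilityMeasure (bernoulliProduct p) := by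
  unfold bernoulliProduct; infer_instance

/-- The set of open coordinates of `ω` inside the finite set `E`. -/
def openIn (E : Finset ι) (ω : ι → Bool) : Finset ι := E.filter fun e => ω e = true

/-- The probability that the set of open coordinates in `E` satisfies `A`. -/
noncomputable def prob (p : ι → unitInterval) (E : Finset ι) (A : Finset ι → Prop) : ℝ :=
  (bernoulliProduct p).real {ω | A (openIn E ω)}

/-- Disjoint occurrence of two properties of finite sets: both hold on disjoint subsets. -/
def DisjointOccurrence (A B : Finset ι → Prop) (s : Finset ι) : Prop :=
  ∃ t u : Finset ι, t ⊆ s ∧ u ⊆ s ∧ Disjoint t u ∧ A t ∧ B u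

lemma openIn_mono {E F : Finset ι} (h : E ⊆ F) (ω : ι → Bool) : openIn E ω ⊆ openIn F ω :=
  Finset.filter_subset_filter _ h

lemma openIn_subset (E : Finset ι) (ω : ι → Bool) : openIn E ω ⊆ E := Finset.filter_subset _ _

lemma mem_openIn {E : Finset ι} {ω : ι → Bool} {e : ι} : e ∈ openIn E ω ↔ e ∈ E ∧ ω e = true := by
  simp [openIn]

lemma prob_nonneg (p : ι → unitInterval) (E : Finset ι) (A : Finset ι → Prop) :
    0 ≤ prob p E A := measureReal_nonneg

lemma prob_le_one (p : ι → unitInterval) (E : Finset ι) (A : Finset ι → Prop) :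
    prob p E A ≤ 1 := measureReal_le_one

lemma prob_mono {p : ι → unitInterval} {E : Finset ι} {A B : Finset ι → Prop}
    (h : ∀ s, s ⊆ E → A s → B s) : prob p E A ≤ prob p E B :=
  measureReal_mono fun ω hω => h _ (openIn_subset E ω) hω

lemma measurableSet_eval_eq (e : ι) (b : Bool) : MeasurableSet {ω : ι → Bool | ω e = b} :=
  measurable_pi_apply (X := fun _ : ι => Bool) e (MeasurableSet.singleton b)

lemma openIn_insert_of_true [DecidableEq ι] {E : Finset ι} {ω : ι → Bool} {e : ι} (h : ω e = true) :
    openIn (insert e E) ω = insert e (openIn E ω) := by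
  simp [openIn, Finset.filter_insert, h]

lemma openIn_insert_of_false [DecidableEq ι] {E : Finset ι} {ω : ι → Bool} {e : ι}
    (h : ω e = false) :
    openIn (insert e E) ω = openIn E ω := by
  simp [openIn, Finset.filter_insert, h]

lemma setOf_openIn_insert [DecidableEq ι] (e : ι) (E : Finset ι) (A : Finset ι → Prop) :
    {ω : ι → Bool | A (openIn (insert e E) ω)} =
      ({ω | ω e = true} ∩ {ω | A (insert e (openIn E ω))}) ∪
      ({ω | ω e = false} ∩ {ω | A (openIn E ω)}) := by
  ext ω
  cases h : ω e
  · simp [h, openIn_insert_of_false h]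
  · simp [h, openIn_insert_of_true h]

lemma measurableSet_openIn (E : Finset ι) (A : Finset ι → Prop) :
    MeasurableSet {ω : ι → Bool | A (openIn E ω)} := by
  classical
  induction E using Finset.induction_on generalizing A with
  | empty => simp [openIn]
  | insert e E _ ih =>
    rw [setOf_openIn_insert]
    refine .union (.inter ?_ (ih fun s => A (insert e s))) (.inter ?_ (ih A))
    · exact measurableSet_eval_eq e true
    · exact measurableSet_eval_eq e false

/-- Comparison of weighted sums of probabilities from a pointwise comparison of the weighted
counts, that is, linearity and monotonicity of the expectation. -/
lemma sum_mul_prob_le_sum_mul_prob {κ κ' : Type*} (p : ι → unitInterval) (E : Finset ι)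
    (T : Finset κ) (T' : Finset κ') (w : κ → ℝ) (w' : κ' → ℝ) (A : κ → Finset ι → Prop)
    (A' : κ' → Finset ι → Prop) [∀ k s, Decidable (A k s)] [∀ k s, Decidable (A' k s)]
    (h : ∀ s ⊆ E, ∑ k ∈ T, w k * (if A k s then 1 else 0) ≤
      ∑ k ∈ T', w' k * (if A' k s then 1 else 0)) :
    ∑ k ∈ T, w k * prob p E (A k) ≤ ∑ k ∈ T', w' k * prob p E (A' k) := by
  have key : ∀ B : Finset ι → Prop, Integrable
      (Set.indicator {ω | B (openIn E ω)} (1 : (ι → Bool) → ℝ))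
      (bernoulliProduct p) := fun B =>
    (integrable_const (1 : ℝ)).indicator (measurableSet_openIn E B)
  have key2 : ∀ B : Finset ι → Prop, prob p E B =
      ∫ ω, Set.indicator {ω | B (openIn E ω)} (1 : (ι → Bool) → ℝ) ω ∂bernoulliProduct p := fun B =>
    (integral_indicator_one (measurableSet_openIn E B)).symm
  simp only [key2, ← integral_const_mul]
  rw [← integral_finsetSum _ fun k _ => (key (A k)).const_mul _,
    ← integral_finsetSum _ fun k _ => (key (A' k)).const_mul _]
  refine integral_mono (integrable_finsetSum _ fun k _ => (key (A k)).const_mul _)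
    (integrable_finsetSum _ fun k _ => (key (A' k)).const_mul _) fun ω => ?_
  simpa [Set.indicator_apply] using h _ (openIn_subset E ω)

lemma prob_exists_le {κ : Type*} (p : ι → unitInterval) (E : Finset ι) (T : Finset κ)
    (A : κ → Finset ι → Prop) :
    prob p E (fun s => ∃ k ∈ T, A k s) ≤ ∑ k ∈ T, prob p E (A k) := by
  have : {ω | ∃ k ∈ T, A k (openIn E ω)} = ⋃ k ∈ T, {ω | A k (openIn E ω)} := by
    ext; simp
  unfold prob
  rw [this]
  exact measureReal_biUnion_finset_le _ _

lemma bernoulliProduct_real_eval (p : ι → unitInterval) (e : ι) (b : Bool) :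
    (bernoulliProduct p).real {ω | ω e = b} = if b then (p e : ℝ) else 1 - p e := by
  have h := (measurePreserving_eval_infinitePi
    (fun e => ProbabilityTheory.bernoulliMeasure true false (p e)) e).measureReal_preimage
      (MeasurableSet.singleton b).nullMeasurableSet
  have : (bernoulliProduct p).real {ω | ω e = b} =
      (ProbabilityTheory.bernoulliMeasure true false (p e)).real {b} := h
  rw [this]
  cases b
  · simp [ProbabilityTheory.bernoulliMeasure_real_apply_of_notMem_of_mem]
  · simp [ProbabilityTheory.bernoulliMeasure_real_apply_of_mem_of_notMem]

lemma prob_empty (p : ι → unitInterval) (A : Finset ι → Prop) [Decidable (A ∅)] :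
    prob p ∅ A = if A ∅ then 1 else 0 := by
  simp only [prob, openIn, Finset.filter_empty]
  split_ifs with h <;> simp [h]

/-- Relabelling the coordinates by a bijection that preserves the edge probabilities. -/
lemma measurePreserving_comp_equiv (p : ι → unitInterval) (σ : ι ≃ ι) (hσ : ∀ e, p (σ e) = p e) :
    MeasurePreserving (fun (ω : ι → Bool) e => ω (σ e)) (bernoulliProduct p)
      (bernoulliProduct p) := by
  refine ⟨by fun_prop, ?_⟩
  unfold bernoulliProduct
  rw [Measure.map_infinitePi_infinitePi_of_inj σ.injective]
  simp only [hσ]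

lemma bernoulliProduct_real_inter (p : ι → unitInterval) {e : ι} {E : Finset ι} (he : e ∉ E)
    (b : Bool) (A : Finset ι → Prop) :
    (bernoulliProduct p).real ({ω | ω e = b} ∩ {ω | A (openIn E ω)}) =
      (bernoulliProduct p).real {ω | ω e = b} * prob p E A := by
  classical
  have hind : ProbabilityTheory.iIndepFun (fun (i : ι) (ω : ι → Bool) => ω i)
      (bernoulliProduct p) := ProbabilityTheory.iIndepFun_infinitePi (X := fun _ b => b)
        (fun _ => measurable_id)
  have h2 := hind.indepFun_finset {e} E (by simpa using he) (fun i => measurable_pi_apply i)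
  have h3 := h2.measure_inter_preimage_eq_mul {x | x ⟨e, by simp⟩ = b}
    {x | A (E.attach.filter (fun i => x i = true) |>.map (Function.Embedding.subtype _))}
    (Set.toFinite _).measurableSet (Set.toFinite _).measurableSet
  have h4 : ∀ ω : ι → Bool, (E.attach.filter (fun i : E => ω i = true)).map
      (Function.Embedding.subtype _) = openIn E ω := by
    intro ω; ext i; simp [mem_openIn, and_comm]
  simp only [Set.preimage_ofPred_eq, h4] at h3
  simp only [prob, Measure.real]
  rw [h3, ENNReal.toReal_mul]

/-- The probability that a given edge of `E` is open. -/
lemma prob_mem (p : ι → unitInterval) {e : ι} {E : Finset ι} (he : e ∈ E) :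
    prob p E (fun s => e ∈ s) = p e := by
  have h := bernoulliProduct_real_eval p e true
  simpa [prob, mem_openIn, he] using h

lemma prob_or_add_prob_and (p : ι → unitInterval) (E : Finset ι) (A B : Finset ι → Prop) :
    prob p E (fun s => A s ∨ B s) + prob p E (fun s => A s ∧ B s) = prob p E A + prob p E B :=
  measureReal_union_add_inter (measurableSet_openIn E B)

variable [DecidableEq ι]

/-- Conditioning on the state of one coordinate. -/
lemma prob_insert (p : ι → unitInterval) {e : ι} {E : Finset ι} (he : e ∉ E)
    (A : Finset ι → Prop) :
    prob p (insert e E) A =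
      p e * prob p E (fun s => A (insert e s)) + (1 - p e) * prob p E A := by
  have h1 := bernoulliProduct_real_inter p he true (fun s => A (insert e s))
  have h2 := bernoulliProduct_real_inter p he false A
  rw [bernoulliProduct_real_eval] at h1 h2
  simp only [if_true] at h1 h2
  rw [prob, setOf_openIn_insert, measureReal_union, h1, h2]
  · simp
  · rw [Set.disjoint_left]
    rintro ω ⟨h, -⟩ ⟨h', -⟩
    simp_all
  · refine .inter ?_ (measurableSet_openIn _ _)
    exact measurableSet_eval_eq e false

/-- The van den Berg–Kesten inequality for increasing events. The induction on the number of
coordinates compares, for the sections `A₀ ⊆ A₁` and `B₀ ⊆ B₁` at a coordinate `e`, the sections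
of the disjoint occurrence: the lower one lies in `(A₁ ∘ B₀) ∩ (A₀ ∘ B₁)`, the upper one in the
union of these two events. -/
theorem prob_disjointOccurrence_le (p : ι → unitInterval) (E : Finset ι)
    {A B : Finset ι → Prop} (hA : Monotone A) (hB : Monotone B) :
    prob p E (DisjointOccurrence A B) ≤ prob p E A * prob p E B := by
  classical
  induction E using Finset.induction_on generalizing A B with
  | empty =>
    have h : DisjointOccurrence A B ∅ ↔ A ∅ ∧ B ∅ := by
      constructor
      · rintro ⟨t, u, ht, hu, -, hA, hB⟩
        rw [Finset.subset_empty.1 ht] at hA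
        rw [Finset.subset_empty.1 hu] at hB
        exact ⟨hA, hB⟩
      · rintro ⟨hA, hB⟩
        exact ⟨∅, ∅, by simp, by simp, by simp, hA, hB⟩
    simp only [prob_empty, h]
    by_cases h1 : A ∅ <;> by_cases h2 : B ∅ <;> simp [h1, h2]
  | insert e E he ih =>
    have hA1 : Monotone fun s => A (insert e s) := fun s t h =>
      hA (Finset.insert_subset_insert e h)
    have hB1 : Monotone fun s => B (insert e s) := fun s t h =>
      hB (Finset.insert_subset_insert e h)
    set A1 := fun s => A (insert e s) with hA1d
    set B1 := fun s => B (insert e s) with hB1d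
    have hAA : ∀ s, A s → A1 s := fun s => hA (Finset.subset_insert e s)
    have hBB : ∀ s, B s → B1 s := fun s => hB (Finset.subset_insert e s)
    rw [prob_insert p he, prob_insert p he, prob_insert p he]
    have hup : ∀ s, DisjointOccurrence A B (insert e s) →
        DisjointOccurrence A1 B s ∨ DisjointOccurrence A B1 s := by
      rintro s ⟨t, u, ht, hu, hd, hAt, hBu⟩
      have hle : ∀ v : Finset ι, v ⊆ insert e (v.erase e) := fun v => by
        intro x hx; by_cases hxe : x = e <;> simp [hxe, hx]
      have ht' : t.erase e ⊆ s := by rw [← Finset.subset_insert_iff]; exact ht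
      have hu' : u.erase e ⊆ s := by rw [← Finset.subset_insert_iff]; exact hu
      by_cases heu : e ∈ u
      · have het : e ∉ t := fun h => Finset.disjoint_left.1 hd h heu
        rw [Finset.erase_eq_of_notMem het] at ht'
        exact Or.inr ⟨t, u.erase e, ht', hu', hd.mono_right (Finset.erase_subset _ _), hAt,
          hB (hle u) hBu⟩
      · rw [Finset.erase_eq_of_notMem heu] at hu'
        exact Or.inl ⟨t.erase e, u, ht', hu', hd.mono_left (Finset.erase_subset _ _),
          hA (hle t) hAt, hBu⟩
    have h00 : ∀ s, DisjointOccurrence A B s →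
        DisjointOccurrence A1 B s ∧ DisjointOccurrence A B1 s := by
      rintro s ⟨t, u, ht, hu, hd, hAt, hBu⟩
      exact ⟨⟨t, u, ht, hu, hd, hAA _ hAt, hBu⟩, ⟨t, u, ht, hu, hd, hAt, hBB _ hBu⟩⟩
    have h11 : ∀ s, DisjointOccurrence A B (insert e s) → DisjointOccurrence A1 B1 s := by
      intro s hs
      rcases hup s hs with ⟨t, u, ht, hu, hd, hAt, hBu⟩ | ⟨t, u, ht, hu, hd, hAt, hBu⟩
      · exact ⟨t, u, ht, hu, hd, hAt, hBB _ hBu⟩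
      · exact ⟨t, u, ht, hu, hd, hAA _ hAt, hBu⟩
    have c1 := prob_mono (p := p) (E := E) fun s _ => hup s
    have c0 := prob_mono (p := p) (E := E) fun s _ => h00 s
    have c2 := prob_mono (p := p) (E := E) fun s _ => h11 s
    have hor := prob_or_add_prob_and p E (DisjointOccurrence A1 B) (DisjointOccurrence A B1)
    have i00 := ih hA hB
    have i10 := ih hA1 hB
    have i01 := ih hA hB1
    have i11 := ih hA1 hB1
    have hp0 : (0 : ℝ) ≤ p e := (p e).2.1
    have hp1 : (0 : ℝ) ≤ 1 - p e := sub_nonneg.2 (p e).2.2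
    set x := (p e : ℝ)
    set c0' := prob p E (DisjointOccurrence A B)
    set c1' := prob p E fun s => DisjointOccurrence A B (insert e s)
    -- inclusion-exclusion for the events `A₁ ∘ B₀` and `A₀ ∘ B₁`
    have hmix : c0' + c1' ≤ prob p E A1 * prob p E B + prob p E A * prob p E B1 := by linarith
    have k1 := mul_le_mul_of_nonneg_left hmix (mul_nonneg hp0 hp1)
    have k2 := mul_le_mul_of_nonneg_left i00 (mul_nonneg hp1 hp1)
    have k3 := mul_le_mul_of_nonneg_left (c2.trans i11) (mul_nonneg hp0 hp0)
    calc x * c1' + (1 - x) * c0'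
        = (1 - x) * (1 - x) * c0' + x * (1 - x) * (c0' + c1') + x * x * c1' := by ring
      _ ≤ _ := by linarith

/-- Probabilities of events on finitely many coordinates depend continuously on the edge
probabilities. -/
lemma continuous_prob {T : Type*} [TopologicalSpace T] {p : T → ι → unitInterval}
    (hp : ∀ e, Continuous fun β => p β e) (E : Finset ι) (A : Finset ι → Prop) :
    Continuous fun β => prob (p β) E A := by
  classical
  induction E using Finset.induction_on generalizing A with
  | empty => simp only [prob_empty]; exact continuous_const
  | insert e E he ih =>
    simp only [prob_insert _ he]
    have := hp e
    exact ((continuous_subtype_val.comp this).mul (ih _)).add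
      ((continuous_const.sub (continuous_subtype_val.comp this)).mul (ih _))

end BK

/-! ### Connected sets in a graph and edge-disjoint pieces of clusters -/

section Graph

variable {V : Type*}

/-- `x` and `y` are joined by a path of edges of `s`. -/
def Joined (s : Finset (Sym2 V)) (x y : V) : Prop :=
  (SimpleGraph.fromEdgeSet (s : Set (Sym2 V))).Reachable x y

lemma Joined.mono {s t : Finset (Sym2 V)} (h : s ⊆ t) {x y : V} (hs : Joined s x y) :
    Joined t x y :=
  SimpleGraph.Reachable.mono (SimpleGraph.fromEdgeSet_mono (by exact_mod_cast h)) hs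

lemma monotone_joined (x y : V) : Monotone fun s : Finset (Sym2 V) => Joined s x y :=
  fun _ _ h hs => hs.mono h

lemma Joined.of_mem {s : Finset (Sym2 V)} {x y : V} (h : s(x, y) ∈ s) : Joined s x y := by
  by_cases hxy : x = y
  · subst hxy; exact SimpleGraph.Reachable.refl _
  · exact SimpleGraph.Adj.reachable (by simp [h, hxy])

open Classical in
/-- The vertices of `Λ` joined to `x` by edges of `s`. -/
noncomputable def clusterIn (Λ : Finset V) (s : Finset (Sym2 V)) (x : V) : Finset V :=
  Λ.filter fun y => Joined s x y

lemma mem_clusterIn {Λ : Finset V} {s : Finset (Sym2 V)} {x y : V} :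
    y ∈ clusterIn Λ s x ↔ y ∈ Λ ∧ Joined s x y := by simp [clusterIn]

lemma clusterIn_mono (Λ : Finset V) {s t : Finset (Sym2 V)} (h : s ⊆ t) (x : V) :
    clusterIn Λ s x ⊆ clusterIn Λ t x := fun y hy => by
  rw [mem_clusterIn] at hy ⊢
  exact ⟨hy.1, hy.2.mono h⟩

/-- Some cluster formed by the edges of `s` has at least `n` vertices in `Λ`. -/
def HasLargeCluster (Λ : Finset V) (n : ℕ) (s : Finset (Sym2 V)) : Prop :=
  ∃ x ∈ Λ, n ≤ (clusterIn Λ s x).card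

lemma monotone_hasLargeCluster (Λ : Finset V) (n : ℕ) : Monotone (HasLargeCluster Λ n) :=
  fun _ _ h ⟨x, hx, hn⟩ => ⟨x, hx, hn.trans (Finset.card_le_card (clusterIn_mono Λ h x))⟩

variable [DecidableEq V]

/-- Connectivity of a finite vertex set in terms of cuts: every proper nonempty subset is joined
by an edge to its complement. The empty set counts as connected. -/
def CutConnected (G : SimpleGraph V) (U : Finset V) : Prop :=
  ∀ A ⊆ U, A.Nonempty → (U \ A).Nonempty → ∃ a ∈ A, ∃ b ∈ U \ A, G.Adj a b

lemma cutConnected_pair {G : SimpleGraph V} {a b : V} (h : G.Adj a b) : CutConnected G {a, b} := by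
  intro A hA hne hne'
  obtain ⟨x, hx⟩ := hne
  obtain ⟨y, hy⟩ := hne'
  have hxm := hA hx
  simp only [Finset.mem_sdiff, Finset.mem_insert, Finset.mem_singleton] at hy hxm
  rcases hxm with rfl | rfl <;> rcases hy with ⟨rfl | rfl, hy⟩
  · exact absurd hx hy
  · exact ⟨_, hx, y, by simp [hy], h⟩
  · exact ⟨_, hx, y, by simp [hy], h.symm⟩
  · exact absurd hx hy

lemma CutConnected.union {G : SimpleGraph V} {X Y : Finset V} (hX : CutConnected G X)
    (hY : CutConnected G Y) {z : V} (hzX : z ∈ X) (hzY : z ∈ Y) : CutConnected G (X ∪ Y) := by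
  have key : ∀ Z : Finset V, CutConnected G Z → Z ⊆ X ∪ Y → ∀ A : Finset V,
      (¬ ∃ a ∈ A, ∃ b ∈ (X ∪ Y) \ A, G.Adj a b) → (∀ x ∈ Z, x ∈ A → ∀ y ∈ Z, y ∈ A) := by
    intro Z hZ hsub A hno x hxZ hxA y hyZ
    by_contra hyA
    obtain ⟨a, ha, b, hb, hab⟩ := hZ (Z ∩ A) Finset.inter_subset_left ⟨x, by simp [hxZ, hxA]⟩
      ⟨y, by simp [hyZ, hyA]⟩
    simp only [Finset.mem_inter, Finset.mem_sdiff, not_and] at ha hb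
    exact hno ⟨a, ha.2, b, Finset.mem_sdiff.2 ⟨hsub hb.1, hb.2 hb.1⟩, hab⟩
  intro A hA hne hne'
  by_contra hno
  have kX := key X hX Finset.subset_union_left A hno
  have kY := key Y hY Finset.subset_union_right A hno
  obtain ⟨x, hx⟩ := hne
  obtain ⟨y, hy⟩ := hne'
  rw [Finset.mem_sdiff, Finset.mem_union] at hy
  have hz : z ∈ A := by
    rcases Finset.mem_union.1 (hA hx) with h | h
    · exact kX x h hx z hzX
    · exact kY x h hx z hzY
  rcases hy.1 with h | h
  · exact hy.2 (kX z hzX hz y h)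
  · exact hy.2 (kY z hzY hz y h)

/-- If `v` separates the connected set `U` into two parts, each part stays connected together
with `v`. -/
lemma CutConnected.insert_part {G : SimpleGraph V} {U D E : Finset V} {v : V}
    (hU : CutConnected G U) (hv : v ∈ U) (hDE : D ∪ E = U.erase v)
    (hno : ∀ a ∈ D, ∀ b ∈ E, ¬ G.Adj a b) : CutConnected G (insert v D) := by
  have hDU : ∀ a ∈ D, a ∈ U ∧ a ≠ v := fun a ha => by
    have : a ∈ U.erase v := hDE ▸ Finset.mem_union_left _ ha
    simpa [and_comm] using this
  have key : ∀ A ⊆ D, A.Nonempty → ∃ a ∈ A, ∃ b ∈ insert v D \ A, G.Adj a b := by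
    intro A hAD hne
    obtain ⟨a, ha, b, hb, hab⟩ := hU A (fun a ha => (hDU a (hAD ha)).1) hne
      ⟨v, Finset.mem_sdiff.2 ⟨hv, fun h => (hDU v (hAD h)).2 rfl⟩⟩
    refine ⟨a, ha, b, ?_, hab⟩
    rw [Finset.mem_sdiff] at hb ⊢
    refine ⟨?_, hb.2⟩
    by_cases hbv : b = v
    · simp [hbv]
    · have : b ∈ D ∪ E := by rw [hDE]; simp [hbv, hb.1]
      rcases Finset.mem_union.1 this with h | h
      · simp [h]
      · exact absurd hab (hno a (hAD ha) b h)
  intro A hA hne hne'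
  by_cases hvA : v ∈ A
  · obtain ⟨a, ha, b, hb, hab⟩ := key (insert v D \ A) (fun x hx => by
      rw [Finset.mem_sdiff, Finset.mem_insert] at hx
      rcases hx.1 with rfl | h
      · exact absurd hvA hx.2
      · exact h) hne'
    refine ⟨b, ?_, a, ha, hab.symm⟩
    simp only [Finset.mem_sdiff, not_and, not_not] at hb
    exact hb.2 hb.1
  · exact key A (fun x hx => by
      rcases Finset.mem_insert.1 (hA hx) with rfl | h
      · exact absurd hx hvA
      · exact h) hne

/-- A connected set with at least `3 n` vertices contains two connected sets with at least `n`
vertices each that share only one vertex: take a splitting `C = U ∪ W`, `U ∩ W = {v}` into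
connected sets with `n ≤ |U|` and `|U|` minimal; removing `v` from `U` shows that `|U| < 2 n`. -/
lemma CutConnected.exists_split {G : SimpleGraph V} {C : Finset V} (hC : CutConnected G C) {n : ℕ}
    (hn : 1 ≤ n) (hcard : 3 * n ≤ C.card) :
    ∃ U W : Finset V, ∃ v : V, U ⊆ C ∧ W ⊆ C ∧ CutConnected G U ∧ CutConnected G W ∧
      U ∩ W = {v} ∧ n ≤ U.card ∧ n ≤ W.card := by
  classical
  let P : ℕ → Prop := fun m => ∃ U W : Finset V, ∃ v : V, U ∪ W = C ∧ CutConnected G U ∧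
      CutConnected G W ∧ U ∩ W = {v} ∧ n ≤ U.card ∧ U.card = m
  have hP : ∃ m, P m := by
    obtain ⟨v, hv⟩ : C.Nonempty := Finset.card_pos.1 (by omega)
    refine ⟨C.card, C, {v}, v, by simpa using hv, hC, ?_, by simpa using hv, by omega, rfl⟩
    intro A hA ⟨a, ha⟩ ⟨b, hb⟩
    have h1 := hA ha
    simp only [Finset.mem_sdiff, Finset.mem_singleton] at h1 hb
    exact absurd ha (by rw [h1, ← hb.1]; exact hb.2)
  obtain ⟨U, W, v, hUW, hU, hW, hint, hnU, hm⟩ := Nat.find_spec hP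
  have hmin : ∀ m, P m → U.card ≤ m := fun m h => hm ▸ Nat.find_min' hP h
  have hvU : v ∈ U := (Finset.mem_inter.1 (hint ▸ Finset.mem_singleton_self v)).1
  have hvW : v ∈ W := (Finset.mem_inter.1 (hint ▸ Finset.mem_singleton_self v)).2
  have hcardUW : U.card + W.card = C.card + 1 := by
    rw [← Finset.card_union_add_card_inter, hUW, hint, Finset.card_singleton]
  have hUlt : U.card < 2 * n := by
    by_contra hge
    push Not at hge
    have hce : (U.erase v).card + 1 = U.card := Finset.card_erase_add_one hvU
    by_cases hconn : CutConnected G (U.erase v)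
    · obtain ⟨a, ha, v', hv', hav⟩ := hU {v} (by simpa using hvU) (by simp)
        (by rw [← Finset.card_pos, Finset.sdiff_singleton_eq_erase]; omega)
      rw [Finset.mem_singleton] at ha
      subst ha
      rw [Finset.sdiff_singleton_eq_erase] at hv'
      have hv'W : v' ∉ W := fun h => by
        have : v' ∈ U ∩ W := Finset.mem_inter.2 ⟨Finset.mem_of_mem_erase hv', h⟩
        rw [hint, Finset.mem_singleton] at this
        exact hav.ne this.symm
      have := hmin _ ⟨U.erase a, W ∪ {a, v'}, v', ?_, hconn,
        hW.union (cutConnected_pair hav) hvW (by simp), ?_, by omega, rfl⟩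
      · omega
      · rw [← hUW]; ext x
        simp only [Finset.mem_union, Finset.mem_erase, Finset.mem_insert, Finset.mem_singleton]
        have : v' ∈ U := Finset.mem_of_mem_erase hv'
        by_cases hxa : x = a
        · simp [hxa, hvU]
        · by_cases hxv : x = v'
          · simp [hxv, this]
          · simp [hxa, hxv]
      · ext x
        have hxi : x ∈ U ∩ W ↔ x = a := by rw [hint, Finset.mem_singleton]
        simp only [Finset.mem_inter] at hxi
        simp only [Finset.mem_inter, Finset.mem_union, Finset.mem_erase, Finset.mem_insert,
          Finset.mem_singleton]
        have h3 := Finset.mem_erase.1 hv'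
        constructor
        · rintro ⟨⟨h1, h2⟩, h | h | h⟩
          · exact absurd (hxi.1 ⟨h2, h⟩) h1
          · exact absurd h h1
          · exact h
        · rintro rfl
          exact ⟨h3, Or.inr (Or.inr rfl)⟩
    · unfold CutConnected at hconn
      push Not at hconn
      obtain ⟨D, hD, hDne, hEne, hno⟩ := hconn
      set E := U.erase v \ D with hE
      have hDE : D ∪ E = U.erase v := Finset.union_sdiff_of_subset hD
      have hdis : Disjoint D E := Finset.disjoint_sdiff
      have hDv := hU.insert_part hvU hDE hno
      have hEv := hU.insert_part hvU (Finset.union_comm D E ▸ hDE)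
        (fun a ha b hb h => hno b hb a ha h.symm)
      have hcDE : D.card + E.card + 1 = U.card := by
        rw [← Finset.card_union_of_disjoint hdis, hDE, hce]
      -- each part, together with `v`, is a smaller candidate for `U`
      have aux : ∀ D E : Finset V, D ∪ E = U.erase v → Disjoint D E → E.Nonempty →
          CutConnected G (insert v D) → CutConnected G (insert v E) →
          D.card + E.card + 1 = U.card → D.card + 1 < n := by
        intro D E hDE hdis hEne hDv hEv hc
        by_contra hlt
        have hDU : ∀ x, x ≠ v → (x ∈ D ∨ x ∈ E ↔ x ∈ U) := fun x hx => by
          rw [← Finset.mem_union, hDE]; simp [hx]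
        have hvDE : v ∉ D ∪ E := by rw [hDE]; simp
        have hvD : v ∉ D := fun h => hvDE (Finset.mem_union_left _ h)
        have hcv := Finset.card_insert_of_notMem hvD
        have hxi : ∀ x, x ∈ U → x ∈ W → x = v := fun x h1 h2 => by
          have : x ∈ U ∩ W := Finset.mem_inter.2 ⟨h1, h2⟩
          rwa [hint, Finset.mem_singleton] at this
        have := hmin _ ⟨insert v D, insert v E ∪ W, v, ?_, hDv,
          hEv.union hW (by simp) hvW, ?_, by omega, rfl⟩
        · have := Finset.card_pos.2 hEne
          omega
        · rw [← hUW]; ext x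
          by_cases hx : x = v
          · simp [hx, hvU]
          · simp only [Finset.mem_union, Finset.mem_insert, hx, false_or]
            rw [← hDU x hx, or_assoc]
        · ext x
          by_cases hx : x = v
          · simp [hx]
          · simp only [Finset.mem_inter, Finset.mem_union, Finset.mem_insert, hx, false_or,
              Finset.mem_singleton, iff_false, not_and, not_or]
            intro hxD
            exact ⟨Finset.disjoint_left.1 hdis hxD,
              fun h => hx (hxi x ((hDU x hx).1 (Or.inl hxD)) h)⟩
      have h1 := aux D E hDE hdis hEne hDv hEv hcDE
      have h2 := aux E D (Finset.union_comm D E ▸ hDE) hdis.symm hDne hEv hDv (by omega)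
      omega
  exact ⟨U, W, v, hUW ▸ Finset.subset_union_left, hUW ▸ Finset.subset_union_right, hU, hW, hint,
    hnU, by omega⟩

lemma cutConnected_clusterIn {Λ : Finset V} {s : Finset (Sym2 V)} (hs : s ⊆ Λ.sym2) (x : V) :
    CutConnected (SimpleGraph.fromEdgeSet (s : Set (Sym2 V))) (clusterIn Λ s x) := by
  intro A hA ⟨a, ha⟩ ⟨b, hb⟩
  rw [Finset.mem_sdiff, mem_clusterIn] at hb
  have hxa := (mem_clusterIn.1 (hA ha)).2
  obtain ⟨p⟩ : Joined s a b := SimpleGraph.Reachable.trans (SimpleGraph.Reachable.symm hxa) hb.1.2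
  obtain ⟨e, -, h1, h2⟩ := p.exists_boundary_dart (A : Set V) ha hb.2
  refine ⟨e.fst, h1, e.snd, ?_, e.adj⟩
  have hadj := e.adj
  rw [SimpleGraph.fromEdgeSet_adj] at hadj
  have hΛ := hs (Finset.mem_coe.1 hadj.1)
  rw [Finset.mk_mem_sym2_iff] at hΛ
  rw [Finset.mem_sdiff, mem_clusterIn]
  exact ⟨⟨hΛ.2, SimpleGraph.Reachable.trans (mem_clusterIn.1 (hA h1)).2
    (SimpleGraph.Adj.reachable e.adj)⟩, h2⟩

/-- A connected set `U` is connected through the non-loop edges with both endpoints in `U`. -/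
lemma CutConnected.joined {s : Finset (Sym2 V)} {U : Finset V}
    (hU : CutConnected (SimpleGraph.fromEdgeSet (s : Set (Sym2 V))) U) {a b : V} (ha : a ∈ U)
    (hb : b ∈ U) : Joined (s.filter fun e => e ∈ U.sym2 ∧ ¬ e.IsDiag) a b := by
  classical
  by_contra hcon
  set t := s.filter fun e => e ∈ U.sym2 ∧ ¬ e.IsDiag
  obtain ⟨x, hx, y, hy, hxy⟩ := hU (clusterIn U t a) (Finset.filter_subset _ _)
    ⟨a, mem_clusterIn.2 ⟨ha, SimpleGraph.Reachable.refl _⟩⟩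
    ⟨b, by rw [Finset.mem_sdiff, mem_clusterIn]; exact ⟨hb, fun h => hcon h.2⟩⟩
  rw [mem_clusterIn] at hx
  rw [Finset.mem_sdiff, mem_clusterIn] at hy
  refine hy.2 ⟨hy.1, SimpleGraph.Reachable.trans hx.2 (Joined.of_mem ?_)⟩
  rw [SimpleGraph.fromEdgeSet_adj] at hxy
  simp only [t, Finset.mem_filter, Finset.mk_mem_sym2_iff, Sym2.mk_isDiag_iff]
  exact ⟨Finset.mem_coe.1 hxy.1, ⟨hx.1, hy.1⟩, hxy.2⟩

/-- A cluster with at least `3 n` vertices contains two edge-disjoint connected pieces with at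
least `n` vertices each. -/
lemma HasLargeCluster.disjointOccurrence {Λ : Finset V} {n : ℕ} (hn : 1 ≤ n)
    {s : Finset (Sym2 V)} (hs : s ⊆ Λ.sym2) (h : HasLargeCluster Λ (3 * n) s) :
    DisjointOccurrence (HasLargeCluster Λ n) (HasLargeCluster Λ n) s := by
  classical
  obtain ⟨x, hx, hcard⟩ := h
  obtain ⟨U, W, v, hUC, hWC, hU, hW, hint, hnU, hnW⟩ :=
    (cutConnected_clusterIn hs x).exists_split hn hcard
  have hv : v ∈ U ∩ W := hint ▸ Finset.mem_singleton_self v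
  have hΛ : ∀ y ∈ clusterIn Λ s x, y ∈ Λ := fun y hy => (mem_clusterIn.1 hy).1
  have large : ∀ U ⊆ clusterIn Λ s x, v ∈ U → n ≤ U.card →
      CutConnected (SimpleGraph.fromEdgeSet (s : Set (Sym2 V))) U →
      HasLargeCluster Λ n (s.filter fun e => e ∈ U.sym2 ∧ ¬ e.IsDiag) := by
    intro U hUC hvU hnU hU
    exact ⟨v, hΛ v (hUC hvU), hnU.trans (Finset.card_le_card fun y hy =>
      mem_clusterIn.2 ⟨hΛ y (hUC hy), hU.joined hvU hy⟩)⟩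
  -- Loops are coordinates of the configuration; without excluding them, the loop at `v` would lie
  -- in both pieces.
  refine ⟨s.filter fun e => e ∈ U.sym2 ∧ ¬ e.IsDiag, s.filter fun e => e ∈ W.sym2 ∧ ¬ e.IsDiag,
    Finset.filter_subset _ _, Finset.filter_subset _ _, ?_,
    large U hUC (Finset.mem_inter.1 hv).1 hnU hU, large W hWC (Finset.mem_inter.1 hv).2 hnW hW⟩
  rw [Finset.disjoint_left]
  intro e he he'
  induction e with
  | _ a b =>
    simp only [Finset.mem_filter, Finset.mk_mem_sym2_iff, Sym2.mk_isDiag_iff] at he he'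
    have h1 : a ∈ U ∩ W := Finset.mem_inter.2 ⟨he.2.1.1, he'.2.1.1⟩
    have h2 : b ∈ U ∩ W := Finset.mem_inter.2 ⟨he.2.1.2, he'.2.1.2⟩
    rw [hint, Finset.mem_singleton] at h1 h2
    exact he.2.2 (h1.trans h2.symm)

/-- A path from `x ∈ S` to `y ∉ S` splits at its first exit `{u, v}` from `S` into three
edge-disjoint pieces. -/
lemma exists_first_exit {G : SimpleGraph V} {S : Finset V} {x y : V} (p : G.Walk x y)
    (hp : p.IsTrail) (hx : x ∈ S) (hy : y ∉ S) :
    ∃ u ∈ S, ∃ v ∉ S, ∃ t₁ t₂ : Finset (Sym2 V), t₁ ⊆ p.edges.toFinset ∧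
      s(u, v) ∈ p.edges.toFinset ∧ t₂ ⊆ p.edges.toFinset ∧ t₁ ⊆ S.sym2 ∧ s(u, v) ∉ t₁ ∧
      s(u, v) ∉ t₂ ∧ Disjoint t₁ t₂ ∧ Joined t₁ x u ∧ Joined t₂ v y := by
  induction p with
  | nil => exact absurd hx hy
  | @cons a b c h p ih =>
    rw [SimpleGraph.Walk.isTrail_cons] at hp
    by_cases hb : b ∈ S
    · obtain ⟨u, hu, v, hv, t₁, t₂, h1, h2, h3, h4, h5, h6, h7, h8, h9⟩ := ih hp.1 hb hy
      have hmem : s(a, b) ∉ p.edges.toFinset := by simpa using hp.2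
      refine ⟨u, hu, v, hv, insert s(a, b) t₁, t₂, ?_, ?_, ?_, ?_, ?_, h6, ?_, ?_, h9⟩
      · rw [SimpleGraph.Walk.edges_cons, List.toFinset_cons]
        exact Finset.insert_subset_insert _ h1
      · rw [SimpleGraph.Walk.edges_cons, List.toFinset_cons]
        exact Finset.mem_insert_of_mem h2
      · rw [SimpleGraph.Walk.edges_cons, List.toFinset_cons]
        exact h3.trans (Finset.subset_insert _ _)
      · exact Finset.insert_subset (by simp [hx, hb]) h4
      · rw [Finset.mem_insert, not_or]
        exact ⟨fun h => hmem (h ▸ h2), h5⟩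
      · rw [Finset.disjoint_insert_left]
        exact ⟨fun h => hmem (h3 h), h7⟩
      · exact SimpleGraph.Reachable.trans (Joined.of_mem (Finset.mem_insert_self _ _))
          (h8.mono (Finset.subset_insert _ _))
    · refine ⟨a, hx, b, hb, ∅, p.edges.toFinset, by simp, by simp, ?_, by simp, by simp,
        by simpa using hp.2, by simp, SimpleGraph.Reachable.refl _, ?_⟩
      · rw [SimpleGraph.Walk.edges_cons, List.toFinset_cons]
        exact Finset.subset_insert _ _
      · refine ⟨p.transfer _ fun e he => ?_⟩
        rw [SimpleGraph.edgeSet_fromEdgeSet]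
        exact ⟨by simpa using he, G.not_isDiag_of_mem_edgeSet (p.edges_subset_edgeSet he)⟩

lemma Joined.exists_first_exit {s : Finset (Sym2 V)} {S : Finset V} {x y : V}
    (h : Joined s x y) (hx : x ∈ S) (hy : y ∉ S) :
    ∃ u ∈ S, ∃ v ∉ S, s(u, v) ∈ s ∧
      DisjointOccurrence (fun t => Joined (t ∩ S.sym2) x u)
        (DisjointOccurrence (fun t => s(u, v) ∈ t) (fun t => Joined t v y)) s := by
  obtain ⟨p, hp⟩ := SimpleGraph.Reachable.exists_isPath h
  have hps : p.edges.toFinset ⊆ s := by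
    intro e he
    have := p.edges_subset_edgeSet (List.mem_toFinset.1 he)
    rw [SimpleGraph.edgeSet_fromEdgeSet] at this
    exact Finset.mem_coe.1 this.1
  obtain ⟨u, hu, v, hv, t₁, t₂, h1, h2, h3, h4, h5, h6, h7, h8, h9⟩ :=
    LongRange.exists_first_exit p hp.isTrail hx hy
  refine ⟨u, hu, v, hv, hps h2, t₁, insert s(u, v) t₂, h1.trans hps,
    Finset.insert_subset (hps h2) (h3.trans hps), ?_, ?_, ?_⟩
  · rw [Finset.disjoint_insert_right]
    exact ⟨h5, h7⟩
  · change Joined (t₁ ∩ S.sym2) x u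
    rwa [Finset.inter_eq_left.2 h4]
  · exact ⟨{s(u, v)}, t₂, by simp, Finset.subset_insert _ _, by simpa using h6, by simp, h9⟩

end Graph

/-! ### Translation invariance -/

section Translation

variable {d : ℕ}

/-- The permutation of the unordered pairs of vertices induced by the translation by `a`. -/
def edgeShift (a : Fin d → ℤ) : Sym2 (Fin d → ℤ) ≃ Sym2 (Fin d → ℤ) where
  toFun := Sym2.map (a + ·)
  invFun := Sym2.map (-a + ·)
  left_inv e := by
    induction e with | _ x y => simp
  right_inv e := by
    induction e with | _ x y => simp

@[simp] lemma edgeShift_mk (a x y : Fin d → ℤ) : edgeShift a s(x, y) = s(a + x, a + y) := rfl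

lemma Kernel.weight_edgeShift (K : Kernel d) (a : Fin d → ℤ) (e : Sym2 (Fin d → ℤ)) :
    K.weight (edgeShift a e) = K.weight e := by
  induction e with
  | _ x y =>
    change K.J (a + x) (a + y) = K.J x y
    rw [K.translation_invariant, K.translation_invariant x y]
    congr 1
    abel

lemma Kernel.edgeProb_edgeShift (K : Kernel d) (β : ℝ≥0) (a : Fin d → ℤ)
    (e : Sym2 (Fin d → ℤ)) : K.edgeProb β (edgeShift a e) = K.edgeProb β e := by
  unfold Kernel.edgeProb
  simp only [K.weight_edgeShift]

lemma Kernel.percolation_eq (K : Kernel d) (β : ℝ≥0) :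
    K.percolation β = bernoulliProduct (K.edgeProb β) := rfl

/-- Probabilities do not increase when an event is replaced by its preimage under a translation.
This inequality, unlike the equality, needs no measurability of the event. -/
lemma Kernel.percolation_shift_le (K : Kernel d) (β : ℝ≥0) (a : Fin d → ℤ) (T : Set (Config d)) :
    (bernoulliProduct (K.edgeProb β)).real {ω | (fun e => ω (edgeShift a e)) ∈ T} ≤
      (bernoulliProduct (K.edgeProb β)).real T := by
  have h := measurePreserving_comp_equiv (K.edgeProb β) (edgeShift a) (K.edgeProb_edgeShift β a)
  have h2 := Measure.le_map_apply h.measurable.aemeasurable (μ := bernoulliProduct (K.edgeProb β)) T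
  rw [h.map_eq] at h2
  exact ENNReal.toReal_mono (measure_ne_top _ _) h2

lemma joined_edgeShift {s t : Finset (Sym2 (Fin d → ℤ))} {a : Fin d → ℤ}
    (hst : ∀ e ∈ s, ∃ e' ∈ t, edgeShift a e' = e) {x y : Fin d → ℤ}
    (h : Joined s (a + x) (a + y)) : Joined t x y := by
  have := SimpleGraph.Reachable.map (G' := SimpleGraph.fromEdgeSet (t : Set (Sym2 (Fin d → ℤ))))
    ⟨fun z => -a + z, by
      intro u v huv
      rw [SimpleGraph.fromEdgeSet_adj] at huv ⊢
      obtain ⟨e', he', heq⟩ := hst _ (Finset.mem_coe.1 huv.1)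
      have : s(-a + u, -a + v) = e' := by
        rw [← (edgeShift a).injective.eq_iff, heq]; simp
      exact ⟨this ▸ he', fun h => huv.2 (by simpa using h)⟩⟩ h
  simpa [Joined] using this

/-- The translate of a finite set of vertices. -/
def translate (a : Fin d → ℤ) (S : Finset (Fin d → ℤ)) : Finset (Fin d → ℤ) :=
  S.map (addLeftEmbedding a)

lemma mem_translate {a x : Fin d → ℤ} {S : Finset (Fin d → ℤ)} :
    x ∈ translate a S ↔ -a + x ∈ S := by
  simp only [translate, Finset.mem_map, addLeftEmbedding_apply]
  constructor
  · rintro ⟨y, hy, rfl⟩; simpa using hy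
  · intro h; exact ⟨_, h, by simp⟩

lemma Kernel.prob_joined_translate_le (K : Kernel d) (β : ℝ≥0) (a : Fin d → ℤ)
    (S : Finset (Fin d → ℤ)) (x y : Fin d → ℤ) :
    prob (K.edgeProb β) (translate a S).sym2 (fun s => Joined s (a + x) (a + y)) ≤
      prob (K.edgeProb β) S.sym2 (fun s => Joined s x y) := by
  refine le_trans (measureReal_mono fun ω hω => ?_)
    (K.percolation_shift_le β a {ω | Joined (openIn S.sym2 ω) x y})
  refine joined_edgeShift (a := a) (fun e he => ?_) hω
  rw [mem_openIn] at he
  induction e with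
  | _ u v =>
    have h1 := he.1
    rw [Finset.mk_mem_sym2_iff, mem_translate, mem_translate] at h1
    exact ⟨s(-a + u, -a + v), by
      rw [mem_openIn, Finset.mk_mem_sym2_iff]; exact ⟨h1, by simpa using he.2⟩, by simp⟩

/-- Inside a finite set, the cluster of any vertex is stochastically smaller than the cluster of
the origin in the whole lattice. -/
lemma Kernel.prob_card_clusterIn_le (K : Kernel d) (β : ℝ≥0) (Λ : Finset (Fin d → ℤ))
    (x : Fin d → ℤ) (n : ℕ) :
    prob (K.edgeProb β) Λ.sym2 (fun s => n ≤ (clusterIn Λ s x).card) ≤ K.clusterTail β n := by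
  refine le_trans (measureReal_mono fun ω hω => ?_)
    (K.percolation_shift_le β x {ω | (n : ℕ∞) ≤ (cluster ω 0).encard})
  change (n : ℕ∞) ≤ (cluster (fun e => ω (edgeShift x e)) 0).encard
  have hω' : n ≤ (clusterIn Λ (openIn Λ.sym2 ω) x).card := hω
  have hinj : Set.InjOn (fun z => -x + z) (clusterIn Λ (openIn Λ.sym2 ω) x : Set (Fin d → ℤ)) :=
    fun a _ b _ h => by simpa using h
  calc (n : ℕ∞) ≤ ((clusterIn Λ (openIn Λ.sym2 ω) x : Set (Fin d → ℤ))).encard := by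
        rw [Set.encard_coe_eq_coe_finsetCard]; exact_mod_cast hω'
    _ = ((fun z => -x + z) '' (clusterIn Λ (openIn Λ.sym2 ω) x : Set (Fin d → ℤ))).encard :=
        hinj.encard_image.symm
    _ ≤ _ := by
        refine Set.encard_le_encard ?_
        rintro _ ⟨z, hz, rfl⟩
        have hz' := (mem_clusterIn.1 (Finset.mem_coe.1 hz)).2
        have := SimpleGraph.Reachable.map
          (G' := openGraph fun e => ω (edgeShift x e))
          ⟨fun z => -x + z, by
            intro u v huv
            rw [SimpleGraph.fromEdgeSet_adj] at huv
            have h1 := (mem_openIn.1 (Finset.mem_coe.1 huv.1)).2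
            simp only [openGraph, SimpleGraph.fromEdgeSet_adj]
            exact ⟨by simpa using h1, fun h => huv.2 (by simpa using h)⟩⟩ hz'
        simpa [cluster] using this

end Translation

/-! ### The finite-volume criterion -/

section Criterion

variable {d : ℕ}

/-- The total weight of the edges from `u` to the complement of `S`. -/
noncomputable def Kernel.outWeight (K : Kernel d) (S : Finset (Fin d → ℤ)) (u : Fin d → ℤ) : ℝ :=
  ∑' v, if v ∈ S then 0 else (K.J u v : ℝ)

/-- The expected weight of the edges leaving `S` from the cluster of `o` in `S`, multiplied
by `β`. -/
noncomputable def Kernel.boundaryFlux (K : Kernel d) (β : ℝ≥0) (S : Finset (Fin d → ℤ))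
    (o : Fin d → ℤ) : ℝ :=
  ∑ u ∈ S, prob (K.edgeProb β) S.sym2 (fun s => Joined s o u) * (β * K.outWeight S u)

lemma Kernel.J_add (K : Kernel d) (u z : Fin d → ℤ) : K.J u (u + z) = K.J 0 z := by
  rw [K.translation_invariant]; congr 1; abel

lemma Kernel.summable_J (K : Kernel d) (u : Fin d → ℤ) : Summable fun v => (K.J u v : ℝ) := by
  have h : Summable fun z => (K.J 0 z : ℝ) := NNReal.summable_coe.2 K.integrable
  rw [← (Equiv.addLeft u).summable_iff]
  refine h.congr fun z => ?_
  simp [K.J_add]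

lemma Kernel.summable_outWeight (K : Kernel d) (S : Finset (Fin d → ℤ)) (u : Fin d → ℤ) :
    Summable fun v => if v ∈ S then 0 else (K.J u v : ℝ) := by
  refine Summable.of_nonneg_of_le (fun v => ?_) (fun v => ?_) (K.summable_J u)
  · split_ifs <;> positivity
  · split_ifs <;> simp

lemma Kernel.outWeight_nonneg (K : Kernel d) (S : Finset (Fin d → ℤ)) (u : Fin d → ℤ) :
    0 ≤ K.outWeight S u :=
  tsum_nonneg fun v => by split_ifs <;> positivity

lemma Kernel.sum_J_le_outWeight (K : Kernel d) (S T : Finset (Fin d → ℤ)) (u : Fin d → ℤ) :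
    ∑ v ∈ T \ S, (K.J u v : ℝ) ≤ K.outWeight S u := by
  refine le_trans (le_of_eq ?_) ((K.summable_outWeight S u).sum_le_tsum (T \ S) fun v _ => ?_)
  · exact Finset.sum_congr rfl fun v hv => by simp [(Finset.mem_sdiff.1 hv).2]
  · split_ifs <;> positivity

lemma Kernel.outWeight_translate (K : Kernel d) (a : Fin d → ℤ) (S : Finset (Fin d → ℤ))
    (u : Fin d → ℤ) : K.outWeight (translate a S) (a + u) = K.outWeight S u := by
  unfold Kernel.outWeight
  rw [← (Equiv.addLeft a).tsum_eq]
  refine tsum_congr fun v => ?_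
  have : K.J (a + u) (a + v) = K.J u v := by
    rw [K.translation_invariant, K.translation_invariant u v]; congr 1; abel
  simp [mem_translate, this]

lemma Kernel.boundaryFlux_translate_le (K : Kernel d) (β : ℝ≥0) (a : Fin d → ℤ)
    (S : Finset (Fin d → ℤ)) (o : Fin d → ℤ) :
    K.boundaryFlux β (translate a S) (a + o) ≤ K.boundaryFlux β S o := by
  unfold Kernel.boundaryFlux
  conv_lhs => rw [translate, Finset.sum_map]
  refine Finset.sum_le_sum fun u _ => ?_
  simp only [addLeftEmbedding_apply]
  change _ * (_ * K.outWeight (translate a S) (a + u)) ≤ _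
  rw [K.outWeight_translate]
  exact mul_le_mul_of_nonneg_right (K.prob_joined_translate_le β a S o u)
    (mul_nonneg β.2 (K.outWeight_nonneg S u))

lemma Kernel.edgeProb_le (K : Kernel d) (β : ℝ≥0) (u v : Fin d → ℤ) :
    (K.edgeProb β s(u, v) : ℝ) ≤ β * K.J u v := by
  have h := Real.add_one_le_exp (-((β : ℝ) * (K.J u v : ℝ)))
  change 1 - Real.exp (-((β : ℝ) * (K.J u v : ℝ))) ≤ _
  linarith

/-- The union bound over the first exit from `S`, with the van den Berg–Kesten inequality applied
to the three pieces of the path. -/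
lemma Kernel.prob_joined_le_first_exit (K : Kernel d) (β : ℝ≥0) (B S : Finset (Fin d → ℤ))
    {x y : Fin d → ℤ} (hx : x ∈ S) (hy : y ∉ S) :
    prob (K.edgeProb β) B.sym2 (fun s => Joined s x y) ≤
      ∑ u ∈ S, ∑ v ∈ B \ S, prob (K.edgeProb β) S.sym2 (fun s => Joined s x u) *
        (β * K.J u v * prob (K.edgeProb β) B.sym2 (fun s => Joined s v y)) := by
  have h1 : prob (K.edgeProb β) B.sym2 (fun s => Joined s x y) ≤
      prob (K.edgeProb β) B.sym2 (fun s => ∃ u ∈ S, ∃ v ∈ B \ S,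
        DisjointOccurrence (fun t => Joined (t ∩ S.sym2) x u)
          (DisjointOccurrence (fun t => s(u, v) ∈ t) (fun t => Joined t v y)) s) := by
    refine prob_mono fun s hs h => ?_
    obtain ⟨u, hu, v, hv, huv, hd⟩ := h.exists_first_exit hx hy
    have := hs huv
    rw [Finset.mk_mem_sym2_iff] at this
    exact ⟨u, hu, v, Finset.mem_sdiff.2 ⟨this.2, hv⟩, hd⟩
  refine h1.trans ((prob_exists_le _ _ _ _).trans (Finset.sum_le_sum fun u _ =>
    (prob_exists_le _ _ _ _).trans (Finset.sum_le_sum fun v _ => ?_)))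
  have m1 : Monotone fun t : Finset (Sym2 (Fin d → ℤ)) => Joined (t ∩ S.sym2) x u :=
    fun s t h hs => Joined.mono (Finset.inter_subset_inter_right h) hs
  have m2 : Monotone fun t : Finset (Sym2 (Fin d → ℤ)) => s(u, v) ∈ t := fun s t h hs => h hs
  have m3 := monotone_joined (V := Fin d → ℤ) v y
  have m23 : Monotone (DisjointOccurrence (fun t : Finset (Sym2 (Fin d → ℤ)) => s(u, v) ∈ t)
      (fun t => Joined t v y)) := by
    rintro s t h ⟨a, b, ha, hb, hr⟩
    exact ⟨a, b, ha.trans h, hb.trans h, hr⟩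
  have e1 : prob (K.edgeProb β) B.sym2 (fun t => Joined (t ∩ S.sym2) x u) ≤
      prob (K.edgeProb β) S.sym2 (fun t => Joined t x u) := by
    refine measureReal_mono fun ω hω => Joined.mono (fun e he => ?_) hω
    rw [Finset.mem_inter, mem_openIn] at he
    exact mem_openIn.2 ⟨he.2, he.1.2⟩
  have e2 : prob (K.edgeProb β) B.sym2 (fun t => s(u, v) ∈ t) ≤ β * K.J u v := by
    by_cases huv : s(u, v) ∈ B.sym2
    · rw [prob_mem _ huv]; exact K.edgeProb_le β u v
    · refine le_trans (le_of_eq ?_) (show (0 : ℝ) ≤ β * K.J u v by positivity)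
      have : {ω : Sym2 (Fin d → ℤ) → Bool | s(u, v) ∈ openIn B.sym2 ω} = ∅ := by
        ext ω; simpa [mem_openIn] using fun h1 h2 => absurd (by simp [h1, h2]) huv
      simp [prob, this]
  refine (prob_disjointOccurrence_le _ _ m1 m23).trans (mul_le_mul e1 ?_ (prob_nonneg _ _ _)
    (prob_nonneg _ _ _))
  exact (prob_disjointOccurrence_le _ _ m2 m3).trans
    (mul_le_mul_of_nonneg_right e2 (prob_nonneg _ _ _))

/-- If the boundary flux of `S` is less than one, then the expected cluster size is bounded
uniformly over finite domains. -/
lemma Kernel.sum_prob_joined_le (K : Kernel d) (β : ℝ≥0) (S : Finset (Fin d → ℤ))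
    {o : Fin d → ℤ} (ho : o ∈ S) (hflux : K.boundaryFlux β S o < 1) (B : Finset (Fin d → ℤ))
    {x : Fin d → ℤ} (hx : x ∈ B) :
    ∑ y ∈ B, prob (K.edgeProb β) B.sym2 (fun s => Joined s x y) ≤
      S.card / (1 - K.boundaryFlux β S o) := by
  set c : (Fin d → ℤ) → ℝ := fun x =>
    ∑ y ∈ B, prob (K.edgeProb β) B.sym2 (fun s => Joined s x y) with hc
  obtain ⟨z, hz, hmax⟩ := B.exists_max_image c ⟨x, hx⟩
  refine (hmax x hx).trans ?_
  rw [le_div_iff₀ (by linarith)]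
  set S' := translate (z - o) S with hS'
  have hzS : z ∈ S' := by rw [hS', mem_translate]; simpa using ho
  have hflux' : K.boundaryFlux β S' z ≤ K.boundaryFlux β S o := by
    have := K.boundaryFlux_translate_le β (z - o) S o
    rwa [sub_add_cancel] at this
  have hc0 : ∀ v, 0 ≤ c v := fun v => Finset.sum_nonneg fun y _ => prob_nonneg _ _ _
  have hin : ∑ y ∈ B ∩ S', prob (K.edgeProb β) B.sym2 (fun s => Joined s z y) ≤ S.card := by
    refine (Finset.sum_le_card_nsmul _ _ 1 fun y _ => prob_le_one _ _ _).trans ?_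
    rw [nsmul_eq_mul, mul_one, ← Finset.card_map (addLeftEmbedding (z - o)) (s := S)]
    exact_mod_cast Finset.card_le_card Finset.inter_subset_right
  have hout : ∑ y ∈ B \ S', prob (K.edgeProb β) B.sym2 (fun s => Joined s z y) ≤
      K.boundaryFlux β S' z * c z := by
    calc ∑ y ∈ B \ S', prob (K.edgeProb β) B.sym2 (fun s => Joined s z y)
        ≤ ∑ y ∈ B \ S', ∑ u ∈ S', ∑ v ∈ B \ S',
          prob (K.edgeProb β) S'.sym2 (fun s => Joined s z u) *
            (β * K.J u v * prob (K.edgeProb β) B.sym2 (fun s => Joined s v y)) :=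
          Finset.sum_le_sum fun y hy =>
            K.prob_joined_le_first_exit β B S' hzS (Finset.mem_sdiff.1 hy).2
      _ = ∑ u ∈ S', prob (K.edgeProb β) S'.sym2 (fun s => Joined s z u) *
            ∑ v ∈ B \ S', β * K.J u v *
              ∑ y ∈ B \ S', prob (K.edgeProb β) B.sym2 (fun s => Joined s v y) := by
          rw [Finset.sum_comm]
          refine Finset.sum_congr rfl fun u _ => ?_
          rw [Finset.sum_comm, Finset.mul_sum]
          refine Finset.sum_congr rfl fun v _ => ?_
          rw [Finset.mul_sum, Finset.mul_sum]
      _ ≤ ∑ u ∈ S', prob (K.edgeProb β) S'.sym2 (fun s => Joined s z u) *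
            (β * K.outWeight S' u * c z) := by
          refine Finset.sum_le_sum fun u _ => mul_le_mul_of_nonneg_left ?_ (prob_nonneg _ _ _)
          calc ∑ v ∈ B \ S', β * K.J u v *
                ∑ y ∈ B \ S', prob (K.edgeProb β) B.sym2 (fun s => Joined s v y)
              ≤ ∑ v ∈ B \ S', β * K.J u v * c z := by
                refine Finset.sum_le_sum fun v hv => mul_le_mul_of_nonneg_left ?_ (by positivity)
                exact (Finset.sum_le_sum_of_subset_of_nonneg Finset.sdiff_subset
                  fun _ _ _ => prob_nonneg _ _ _).trans (hmax v (Finset.mem_sdiff.1 hv).1)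
            _ = β * (∑ v ∈ B \ S', (K.J u v : ℝ)) * c z := by
                generalize c z = m
                rw [← Finset.sum_mul, Finset.mul_sum]
            _ ≤ _ := by
                gcongr
                · exact hc0 z
                · exact K.sum_J_le_outWeight S' B u
      _ = K.boundaryFlux β S' z * c z := by
          rw [Kernel.boundaryFlux, Finset.sum_mul]
          exact Finset.sum_congr rfl fun u _ => by ring
  have hsplit : c z = ∑ y ∈ B ∩ S', prob (K.edgeProb β) B.sym2 (fun s => Joined s z y) +
      ∑ y ∈ B \ S', prob (K.edgeProb β) B.sym2 (fun s => Joined s z y) :=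
    (Finset.sum_inter_add_sum_sdiff B S' _).symm
  nlinarith [mul_le_mul_of_nonneg_right hflux' (hc0 z)]

/-- A path has finitely many vertices, so its endpoints are joined inside a finite set. -/
lemma exists_joined_openIn {ω : Config d} {x y : Fin d → ℤ} (h : (openGraph ω).Reachable x y) :
    ∃ B : Finset (Fin d → ℤ), x ∈ B ∧ y ∈ B ∧ Joined (openIn B.sym2 ω) x y := by
  obtain ⟨p⟩ := h
  refine ⟨p.support.toFinset, by simp, by simp, ⟨p.transfer _ fun e he => ?_⟩⟩
  have h1 := p.edges_subset_edgeSet he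
  rw [openGraph, SimpleGraph.edgeSet_fromEdgeSet] at h1
  rw [SimpleGraph.edgeSet_fromEdgeSet]
  refine ⟨Finset.mem_coe.2 (mem_openIn.2 ⟨?_, h1.1⟩), h1.2⟩
  induction e with
  | _ a b =>
    rw [Finset.mk_mem_sym2_iff, List.mem_toFinset, List.mem_toFinset]
    exact ⟨p.fst_mem_support_of_mem_edges he, p.snd_mem_support_of_mem_edges he⟩

lemma exists_card_clusterIn {ω : Config d} (h : (cluster ω 0).encard = ⊤) (n : ℕ) :
    ∃ B : Finset (Fin d → ℤ), 0 ∈ B ∧ n ≤ (clusterIn B (openIn B.sym2 ω) 0).card := by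
  obtain ⟨T, hT, hcard⟩ := (Set.encard_eq_top_iff.1 h).exists_subset_card_eq n
  choose! B hB using fun (y : Fin d → ℤ) (hy : y ∈ cluster ω 0) => exists_joined_openIn hy
  have hsub : ∀ y ∈ T, B y ⊆ insert 0 (T.biUnion B) := fun y hy =>
    (Finset.subset_biUnion_of_mem B hy).trans (Finset.subset_insert _ _)
  refine ⟨insert 0 (T.biUnion B), by simp, hcard ▸ Finset.card_le_card fun y hy => ?_⟩
  have hy' := hB y (hT hy)
  exact mem_clusterIn.2 ⟨hsub y hy hy'.2.1,
    hy'.2.2.mono (openIn_mono (Finset.sym2_mono (hsub y hy)) ω)⟩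

lemma mul_prob_card_clusterIn_le {V : Type*} [DecidableEq V] (p : Sym2 V → unitInterval)
    (B : Finset V) (x : V) (n : ℕ) :
    n * prob p B.sym2 (fun s => n ≤ (clusterIn B s x).card) ≤
      ∑ y ∈ B, prob p B.sym2 (fun s => Joined s x y) := by
  classical
  have := sum_mul_prob_le_sum_mul_prob p B.sym2 {()} B (fun _ => (n : ℝ)) (fun _ => 1)
    (fun _ s => n ≤ (clusterIn B s x).card) (fun y s => Joined s x y) (fun s _ => by
      simp only [Finset.sum_singleton, one_mul, Finset.sum_boole]
      split_ifs with h
      · simpa [clusterIn] using h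
      · simp)
  simpa using this

lemma Kernel.percolation_infinite_eq_zero (K : Kernel d) (β : ℝ≥0) (S : Finset (Fin d → ℤ))
    {o : Fin d → ℤ} (ho : o ∈ S) (hflux : K.boundaryFlux β S o < 1) :
    K.percolation β {ω | (cluster ω 0).encard = ⊤} = 0 := by
  rw [K.percolation_eq]
  set M : ℝ := S.card / (1 - K.boundaryFlux β S o)
  have hM : 0 ≤ M := div_nonneg (by positivity) (by linarith)
  have key : ∀ n : ℕ, 1 ≤ n → bernoulliProduct (K.edgeProb β) {ω | (cluster ω 0).encard = ⊤} ≤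
      ENNReal.ofReal (M / n) := by
    intro n hn
    have hsub : {ω : Config d | (cluster ω 0).encard = ⊤} ⊆ ⋃ B : Finset (Fin d → ℤ),
        {ω | 0 ∈ B ∧ n ≤ (clusterIn B (openIn B.sym2 ω) 0).card} := fun ω hω => by
      obtain ⟨B, h⟩ := exists_card_clusterIn hω n
      exact Set.mem_iUnion.2 ⟨B, h⟩
    refine (measure_mono hsub).trans ?_
    rw [Directed.measure_iUnion]
    · refine iSup_le fun B => ?_
      by_cases h0 : (0 : Fin d → ℤ) ∈ B
      · have h1 := (mul_prob_card_clusterIn_le (K.edgeProb β) B 0 n).trans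
          (K.sum_prob_joined_le β S ho hflux B h0)
        have h2 : prob (K.edgeProb β) B.sym2 (fun s => n ≤ (clusterIn B s 0).card) ≤ M / n := by
          rw [le_div_iff₀ (by positivity)]; linarith
        simp only [h0, true_and]
        rw [← ofReal_measureReal]
        exact ENNReal.ofReal_le_ofReal h2
      · simp [h0]
    · intro B B'
      have aux : ∀ B B' : Finset (Fin d → ℤ), B ⊆ B' →
          {ω : Config d | 0 ∈ B ∧ n ≤ (clusterIn B (openIn B.sym2 ω) 0).card} ⊆
          {ω | 0 ∈ B' ∧ n ≤ (clusterIn B' (openIn B'.sym2 ω) 0).card} := by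
        rintro B B' h ω ⟨h0, hn⟩
        refine ⟨h h0, hn.trans (Finset.card_le_card fun y hy => ?_)⟩
        rw [mem_clusterIn] at hy ⊢
        exact ⟨h hy.1, hy.2.mono (openIn_mono (Finset.sym2_mono h) ω)⟩
      exact ⟨B ∪ B', aux _ _ Finset.subset_union_left, aux _ _ Finset.subset_union_right⟩
  have hlim : Filter.Tendsto (fun n : ℕ => ENNReal.ofReal (M / n)) Filter.atTop (nhds 0) := by
    have := ENNReal.tendsto_ofReal (tendsto_const_div_atTop_nhds_zero_nat M)
    simpa using this
  refine le_antisymm (ge_of_tendsto hlim ?_) bot_le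
  filter_upwards [Filter.eventually_ge_atTop 1] with n hn using key n hn

lemma Kernel.continuous_edgeProb (K : Kernel d) (e : Sym2 (Fin d → ℤ)) :
    Continuous fun β => K.edgeProb β e := by
  refine Continuous.subtype_mk ?_ _
  fun_prop

lemma Kernel.continuous_boundaryFlux (K : Kernel d) (S : Finset (Fin d → ℤ)) (o : Fin d → ℤ) :
    Continuous fun β => K.boundaryFlux β S o := by
  unfold Kernel.boundaryFlux
  refine continuous_finsetSum _ fun u _ => ?_
  exact (continuous_prob K.continuous_edgeProb _ _).mul (by fun_prop)

/-- At the critical point the boundary flux of every finite set is at least one: otherwise, by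
continuity, it would be less than one at some supercritical parameter. -/
theorem Kernel.one_le_boundaryFlux (K : Kernel d) (hβc : K.criticalParameter < ⊤)
    (S : Finset (Fin d → ℤ)) {o : Fin d → ℤ} (ho : o ∈ S) :
    1 ≤ K.boundaryFlux K.criticalParameter.toNNReal S o := by
  by_contra hlt
  push Not at hlt
  set b := K.criticalParameter.toNNReal with hb
  have hbc : K.criticalParameter = b := (ENNReal.coe_toNNReal hβc.ne).symm
  obtain ⟨U, hU, hmem⟩ : ∃ c > b, ∀ β ∈ Set.Ico b c, K.boundaryFlux β S o < 1 := by
    have h1 := (K.continuous_boundaryFlux S o).continuousAt (x := b) |>.eventually_lt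
      continuousAt_const hlt
    have h2 : ∀ᶠ β in nhdsWithin b (Set.Ici b), K.boundaryFlux β S o < 1 :=
      h1.filter_mono nhdsWithin_le_nhds
    obtain ⟨c, hc, hcs⟩ := (mem_nhdsGE_iff_exists_Ico_subset' (lt_add_one b)).1 h2
    exact ⟨c, hc, fun β hβ => hcs hβ⟩
  have hlt' : K.criticalParameter < (U : ℝ≥0∞) := by rw [hbc]; exact_mod_cast hU
  obtain ⟨_, ⟨β, rfl, hpos⟩, hβ⟩ := sInf_lt_iff.1 hlt'
  have hbβ : b ≤ β := by
    have : K.criticalParameter ≤ β := sInf_le ⟨β, rfl, hpos⟩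
    rw [hbc] at this
    exact_mod_cast this
  exact hpos.ne' (K.percolation_infinite_eq_zero β S ho (hmem β ⟨hbβ, by exact_mod_cast hβ⟩))

end Criterion

/-! ### The weight of the edges leaving a box -/

section Box

variable {d : ℕ}

/-- The box `{0, …, r - 1}^d`. -/
noncomputable def box (d r : ℕ) : Finset (Fin d → ℤ) :=
  Fintype.piFinset fun _ => Finset.Ico (0 : ℤ) r

lemma card_box (d r : ℕ) : (box d r).card = r ^ d := by
  simp [box, Fintype.card_piFinset]

lemma euclideanNorm_eq_norm (z : Fin d → ℤ) :
    euclideanNorm z = ‖(WithLp.toLp 2 fun i => (z i : ℝ) : EuclideanSpace ℝ (Fin d))‖ := by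
  rw [EuclideanSpace.norm_eq]
  simp [euclideanNorm]

lemma euclideanNorm_nonneg (z : Fin d → ℤ) : 0 ≤ euclideanNorm z := Real.sqrt_nonneg _

lemma euclideanNorm_neg (z : Fin d → ℤ) : euclideanNorm (-z) = euclideanNorm z := by
  simp [euclideanNorm]

lemma abs_le_euclideanNorm (z : Fin d → ℤ) (i : Fin d) : |(z i : ℝ)| ≤ euclideanNorm z := by
  apply Real.abs_le_sqrt
  exact Finset.single_le_sum (f := fun i => (z i : ℝ) ^ 2) (fun j _ => sq_nonneg _)
    (Finset.mem_univ i)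

lemma euclideanNorm_pos {z : Fin d → ℤ} (hz : z ≠ 0) : 0 < euclideanNorm z := by
  obtain ⟨i, hi⟩ := Function.ne_iff.1 hz
  refine lt_of_lt_of_le ?_ (abs_le_euclideanNorm z i)
  rw [abs_pos]
  exact_mod_cast hi

/-- The Epstein-type sum `∑ ‖z‖ ^ s` over `ℤ^d` converges for `s < -d`. -/
lemma summable_euclideanNorm_rpow {s : ℝ} (hs : s < -(d : ℝ)) :
    Summable fun z : Fin d → ℤ => euclideanNorm z ^ s := by
  let b := (EuclideanSpace.basisFun (Fin d) ℝ).toBasis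
  let L := Submodule.span ℤ (Set.range b)
  have hrank : Module.finrank ℤ L = d := by
    have := ZLattice.rank ℝ L
    rw [this]; simp
  have hmem : ∀ z : Fin d → ℤ,
      (WithLp.toLp 2 fun i => (z i : ℝ) : EuclideanSpace ℝ (Fin d)) ∈ L := by
    intro z
    have : (WithLp.toLp 2 fun i => (z i : ℝ) : EuclideanSpace ℝ (Fin d)) = ∑ i, z i • b i := by
      ext j
      simp [b, Pi.single_apply]
    rw [this]
    exact Submodule.sum_mem _ fun i _ => Submodule.smul_mem _ _
      (Submodule.subset_span ⟨i, rfl⟩)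
  have h := ZLattice.summable_norm_rpow L s (by rw [hrank]; exact hs)
  have hinj : Function.Injective fun z : Fin d → ℤ =>
      (⟨WithLp.toLp 2 fun i => (z i : ℝ), hmem z⟩ : L) := by
    intro z z' hzz
    have h1 := congrArg (fun x : L => (x : EuclideanSpace ℝ (Fin d))) hzz
    funext i
    have h2 := congrArg (fun x : EuclideanSpace ℝ (Fin d) => x i) h1
    simpa using h2
  refine (h.comp_injective hinj).congr fun z => ?_
  rw [euclideanNorm_eq_norm]
  rfl

lemma card_filter_Ico_add_notMem_le (r : ℕ) (k : ℤ) :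
    ((Finset.Ico (0 : ℤ) r).filter fun a => a + k ∉ Finset.Ico (0 : ℤ) r).card ≤
      min r k.natAbs := by
  refine le_min ((Finset.card_filter_le _ _).trans (by simp)) ?_
  rcases le_total 0 k with hk | hk
  · calc _ ≤ (Finset.Ico ((r : ℤ) - k) r).card := Finset.card_le_card fun a ha => by
          simp only [Finset.mem_filter, Finset.mem_Ico] at ha ⊢; omega
      _ ≤ _ := by rw [Int.card_Ico]; omega
  · calc _ ≤ (Finset.Ico (0 : ℤ) (-k)).card := Finset.card_le_card fun a ha => by
          simp only [Finset.mem_filter, Finset.mem_Ico] at ha ⊢; omega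
      _ ≤ _ := by rw [Int.card_Ico]; omega

lemma card_filter_box_coord (r : ℕ) (i : Fin d) (k : ℤ) :
    ((box d r).filter fun x => x i + k ∉ Finset.Ico (0 : ℤ) r).card =
      ((Finset.Ico (0 : ℤ) r).filter fun a => a + k ∉ Finset.Ico (0 : ℤ) r).card *
        r ^ (d - 1) := by
  set F := (Finset.Ico (0 : ℤ) r).filter fun a => a + k ∉ Finset.Ico (0 : ℤ) r
  have h : ((box d r).filter fun x => x i + k ∉ Finset.Ico (0 : ℤ) r) =
      Fintype.piFinset fun j => if j = i then F else Finset.Ico (0 : ℤ) r := by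
    ext x
    simp only [box, Finset.mem_filter, Fintype.mem_piFinset]
    constructor
    · rintro ⟨h1, h2⟩ j
      split_ifs with hj
      · subst hj; exact Finset.mem_filter.2 ⟨h1 j, h2⟩
      · exact h1 j
    · intro h1
      have hi := h1 i
      rw [if_pos rfl] at hi
      refine ⟨fun j => ?_, (Finset.mem_filter.1 hi).2⟩
      by_cases hj : j = i
      · subst hj; exact (Finset.mem_filter.1 hi).1
      · have := h1 j; rwa [if_neg hj] at this
  rw [h, Fintype.card_piFinset, ← Finset.mul_prod_erase _ _ (Finset.mem_univ i), if_pos rfl]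
  congr 1
  rw [Finset.prod_congr rfl (g := fun _ => r) fun j hj => by simp [Finset.ne_of_mem_erase hj]]
  simp

/-- The number of points of a box that a translation by `z` moves out of it is at most
`d r ^ (d - 1) min (r, ‖z‖)`, which is bounded by interpolation. -/
lemma card_filter_box_add_notMem_le {r : ℕ} (hr : 1 ≤ r) (z : Fin d → ℤ) {θ : ℝ} (h0 : 0 ≤ θ)
    (h1 : θ ≤ 1) :
    (((box d r).filter fun x => x + z ∉ box d r).card : ℝ) ≤
      d * (r : ℝ) ^ ((d : ℝ) - θ) * euclideanNorm z ^ θ := by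
  have hr0 : (0 : ℝ) < r := by exact_mod_cast hr
  have hsub : ((box d r).filter fun x => x + z ∉ box d r) ⊆ Finset.univ.biUnion fun i =>
      (box d r).filter fun x => x i + z i ∉ Finset.Ico (0 : ℤ) r := by
    intro x hx
    rw [Finset.mem_filter] at hx
    obtain ⟨hx, hxz⟩ := hx
    rw [box, Fintype.mem_piFinset, not_forall] at hxz
    obtain ⟨i, hi⟩ := hxz
    exact Finset.mem_biUnion.2 ⟨i, Finset.mem_univ i, Finset.mem_filter.2 ⟨hx, hi⟩⟩
  have hcoord : ∀ i : Fin d,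
      (((box d r).filter fun x => x i + z i ∉ Finset.Ico (0 : ℤ) r).card : ℝ) ≤
        (r : ℝ) ^ ((d : ℝ) - θ) * euclideanNorm z ^ θ := by
    intro i
    have hd : 1 ≤ d := Nat.one_le_of_lt i.2
    rw [card_filter_box_coord, Nat.cast_mul]
    have h2 := card_filter_Ico_add_notMem_le r (z i)
    set m := ((Finset.Ico (0 : ℤ) r).filter fun a => a + z i ∉ Finset.Ico (0 : ℤ) r).card
    have hmr : (m : ℝ) ≤ r := by exact_mod_cast h2.trans (min_le_left _ _)
    have hmz : (m : ℝ) ≤ euclideanNorm z := by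
      refine le_trans ?_ (abs_le_euclideanNorm z i)
      have : (m : ℝ) ≤ ((z i).natAbs : ℝ) := by exact_mod_cast h2.trans (min_le_right _ _)
      rwa [Nat.cast_natAbs, Int.cast_abs] at this
    have hm : (m : ℝ) ≤ (r : ℝ) ^ (1 - θ) * euclideanNorm z ^ θ := by
      calc (m : ℝ) = (m : ℝ) ^ (1 - θ) * (m : ℝ) ^ θ := by
            rw [← Real.rpow_add' (by positivity) (by norm_num)]; norm_num
        _ ≤ _ := by
            gcongr
    calc (m : ℝ) * ((r ^ (d - 1) : ℕ) : ℝ)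
        ≤ ((r : ℝ) ^ (1 - θ) * euclideanNorm z ^ θ) * ((r ^ (d - 1) : ℕ) : ℝ) := by gcongr
      _ = ((r : ℝ) ^ (1 - θ) * (r : ℝ) ^ ((d : ℝ) - 1)) * euclideanNorm z ^ θ := by
          rw [Nat.cast_pow, ← Real.rpow_natCast, Nat.cast_sub hd, Nat.cast_one]; ring
      _ = _ := by rw [← Real.rpow_add hr0]; ring_nf
  calc _ ≤ ((Finset.univ.biUnion fun i =>
        (box d r).filter fun x => x i + z i ∉ Finset.Ico (0 : ℤ) r).card : ℝ) := by
        exact_mod_cast Finset.card_le_card hsub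
    _ ≤ ∑ i : Fin d, (((box d r).filter fun x => x i + z i ∉ Finset.Ico (0 : ℤ) r).card : ℝ) := by
        exact_mod_cast Finset.card_biUnion_le
    _ ≤ ∑ i : Fin d, (r : ℝ) ^ ((d : ℝ) - θ) * euclideanNorm z ^ θ :=
        Finset.sum_le_sum fun i _ => hcoord i
    _ = _ := by simp [mul_assoc]

lemma Kernel.sum_outWeight_eq (K : Kernel d) (Λ : Finset (Fin d → ℤ)) :
    ∑ x ∈ Λ, K.outWeight Λ x =
      ∑' z, (K.J 0 z : ℝ) * ((Λ.filter fun x => x + z ∉ Λ).card : ℝ) := by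
  have h : ∀ x, K.outWeight Λ x = ∑' z, if x + z ∈ Λ then 0 else (K.J 0 z : ℝ) := fun x => by
    rw [Kernel.outWeight, ← (Equiv.addLeft x).tsum_eq]
    simp [K.J_add]
  have hs : ∀ x ∈ Λ, Summable fun z => if x + z ∈ Λ then 0 else (K.J 0 z : ℝ) := fun x _ => by
    refine ((Equiv.addLeft x).summable_iff.2 (K.summable_outWeight Λ x)).congr fun z => ?_
    simp [K.J_add]
  simp only [h]
  rw [← Summable.tsum_finsetSum hs]
  refine tsum_congr fun z => ?_
  rw [Finset.card_filter, Nat.cast_sum, Finset.mul_sum]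
  refine Finset.sum_congr rfl fun x _ => ?_
  by_cases hx : x + z ∈ Λ <;> simp [hx]

/-- The total weight of the edges leaving a box of side `r` is `O(r ^ (d - θ))` for every
`θ < min α 1`, since `∑ z, J(0, z) ‖z‖ ^ θ` converges. -/
lemma Kernel.exists_sum_outWeight_box_le (K : Kernel d) {α θ C₁ : ℝ} (hθ : 0 < θ) (hθ1 : θ ≤ 1)
    (hθα : θ < α) (hJ : ∀ x y : Fin d → ℤ, x ≠ y →
      (K.J x y : ℝ) ≤ C₁ * euclideanNorm (x - y) ^ (-(d : ℝ) - α)) :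
    ∃ C : ℝ, 0 ≤ C ∧ ∀ r : ℕ, 1 ≤ r →
      ∑ x ∈ box d r, K.outWeight (box d r) x ≤ C * (r : ℝ) ^ ((d : ℝ) - θ) := by
  have hterm : ∀ z : Fin d → ℤ, (K.J 0 z : ℝ) * euclideanNorm z ^ θ ≤
      |C₁| * euclideanNorm z ^ (-(d : ℝ) - α + θ) := by
    intro z
    by_cases hz : z = 0
    · have : euclideanNorm z = 0 := by simp [hz, euclideanNorm]
      rw [this, Real.zero_rpow hθ.ne', mul_zero]
      exact mul_nonneg (abs_nonneg _) (Real.rpow_nonneg le_rfl _)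
    · have h1 := hJ 0 z (Ne.symm hz)
      rw [zero_sub, euclideanNorm_neg] at h1
      have hpos := euclideanNorm_pos hz
      rw [Real.rpow_add hpos, ← mul_assoc]
      refine mul_le_mul_of_nonneg_right (h1.trans ?_) (by positivity)
      exact mul_le_mul_of_nonneg_right (le_abs_self _) (by positivity)
  have hsum : Summable fun z : Fin d → ℤ => (K.J 0 z : ℝ) * euclideanNorm z ^ θ :=
    Summable.of_nonneg_of_le (fun z => mul_nonneg (K.J 0 z).2
      (Real.rpow_nonneg (euclideanNorm_nonneg z) _)) hterm
      ((summable_euclideanNorm_rpow (by linarith)).mul_left _)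
  refine ⟨d * ∑' z : Fin d → ℤ, (K.J 0 z : ℝ) * euclideanNorm z ^ θ,
    mul_nonneg (by positivity) (tsum_nonneg fun z => mul_nonneg (K.J 0 z).2
      (Real.rpow_nonneg (euclideanNorm_nonneg z) _)), fun r hr => ?_⟩
  have hle : ∀ z : Fin d → ℤ,
      (K.J 0 z : ℝ) * (((box d r).filter fun x => x + z ∉ box d r).card : ℝ) ≤
        (d * (r : ℝ) ^ ((d : ℝ) - θ)) * ((K.J 0 z : ℝ) * euclideanNorm z ^ θ) := fun z => by
    calc _ ≤ (K.J 0 z : ℝ) * (d * (r : ℝ) ^ ((d : ℝ) - θ) * euclideanNorm z ^ θ) :=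
          mul_le_mul_of_nonneg_left (card_filter_box_add_notMem_le hr z hθ.le hθ1) (K.J 0 z).2
      _ = _ := by ring
  have hs2 := hsum.mul_left (d * (r : ℝ) ^ ((d : ℝ) - θ))
  rw [K.sum_outWeight_eq]
  refine (Summable.tsum_le_tsum hle (Summable.of_nonneg_of_le (fun z => by positivity) hle hs2)
    hs2).trans (le_of_eq ?_)
  rw [tsum_mul_left]
  ring

end Box

/-! ### The size of the clusters in a finite set -/

section ClusterSize

variable {d : ℕ}

lemma prob_hasLargeCluster_pow_le {V : Type*} [DecidableEq V] (p : Sym2 V → unitInterval)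
    (Λ : Finset V) {n : ℕ} (hn : 1 ≤ n) (k : ℕ) :
    prob p Λ.sym2 (HasLargeCluster Λ (3 ^ k * n)) ≤
      prob p Λ.sym2 (HasLargeCluster Λ n) ^ 2 ^ k := by
  induction k with
  | zero => simp
  | succ k ih =>
    calc prob p Λ.sym2 (HasLargeCluster Λ (3 ^ (k + 1) * n))
        ≤ prob p Λ.sym2 (DisjointOccurrence (HasLargeCluster Λ (3 ^ k * n))
            (HasLargeCluster Λ (3 ^ k * n))) := by
          refine prob_mono fun s hs h => HasLargeCluster.disjointOccurrence ?_ hs ?_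
          · exact Nat.mul_pos (by positivity) hn
          · rwa [← mul_assoc, ← pow_succ']
      _ ≤ prob p Λ.sym2 (HasLargeCluster Λ (3 ^ k * n)) ^ 2 := by
          rw [sq]
          exact prob_disjointOccurrence_le _ _ (monotone_hasLargeCluster Λ _)
            (monotone_hasLargeCluster Λ _)
      _ ≤ (prob p Λ.sym2 (HasLargeCluster Λ n) ^ 2 ^ k) ^ 2 :=
          pow_le_pow_left₀ (prob_nonneg _ _ _) ih 2
      _ = _ := by rw [← pow_mul, pow_succ]

/-- Each of the at least `n` vertices of a large cluster sees a cluster of size at least `n`. -/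
lemma mul_prob_hasLargeCluster_le {V : Type*} [DecidableEq V] (p : Sym2 V → unitInterval)
    (Λ : Finset V) (n : ℕ) :
    n * prob p Λ.sym2 (HasLargeCluster Λ n) ≤
      ∑ y ∈ Λ, prob p Λ.sym2 (fun s => n ≤ (clusterIn Λ s y).card) := by
  classical
  have := sum_mul_prob_le_sum_mul_prob p Λ.sym2 {()} Λ (fun _ => (n : ℝ)) (fun _ => 1)
    (fun _ s => HasLargeCluster Λ n s) (fun y s => n ≤ (clusterIn Λ s y).card) (fun s _ => by
      simp only [Finset.sum_singleton, one_mul, Finset.sum_boole]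
      split_ifs with h
      · obtain ⟨x, hx, hn⟩ := h
        rw [mul_one]
        refine Nat.cast_le.2 (hn.trans (Finset.card_le_card fun y hy => ?_))
        rw [mem_clusterIn] at hy
        refine Finset.mem_filter.2 ⟨hy.1, hn.trans (Finset.card_le_card fun z hz => ?_)⟩
        rw [mem_clusterIn] at hz ⊢
        exact ⟨hz.1, SimpleGraph.Reachable.trans (SimpleGraph.Reachable.symm hy.2) hz.2⟩
      · simp)
  simpa using this

/-- The expected cluster size, truncated at `N`. -/
lemma sum_prob_joined_le_truncated {V : Type*} [DecidableEq V] (p : Sym2 V → unitInterval)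
    (Λ : Finset V) {x : V} (hx : x ∈ Λ) (N : ℕ) :
    ∑ y ∈ Λ, prob p Λ.sym2 (fun s => Joined s x y) ≤
      ∑ k ∈ Finset.Icc 1 N, prob p Λ.sym2 (fun s => k ≤ (clusterIn Λ s x).card) +
        Λ.card * prob p Λ.sym2 (HasLargeCluster Λ N) := by
  classical
  have key : ∀ s, ((clusterIn Λ s x).card : ℝ) ≤
      ∑ k ∈ Finset.Icc 1 N, (if k ≤ (clusterIn Λ s x).card then 1 else 0) +
        Λ.card * (if HasLargeCluster Λ N s then 1 else 0) := by
    intro s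
    rw [Finset.sum_boole]
    split_ifs with h
    · have : ((clusterIn Λ s x).card : ℝ) ≤ Λ.card := by
        exact_mod_cast Finset.card_le_card (Finset.filter_subset _ _)
      rw [mul_one]
      linarith [Nat.cast_nonneg (α := ℝ)
        ((Finset.Icc 1 N).filter fun k => k ≤ (clusterIn Λ s x).card).card]
    · have hlt : (clusterIn Λ s x).card < N := by
        by_contra hge
        exact h ⟨x, hx, not_lt.1 hge⟩
      have : ((Finset.Icc 1 N).filter fun k => k ≤ (clusterIn Λ s x).card) =
          Finset.Icc 1 (clusterIn Λ s x).card := by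
        ext k; simp only [Finset.mem_filter, Finset.mem_Icc]; omega
      rw [this]
      simp
  have := sum_mul_prob_le_sum_mul_prob p Λ.sym2 Λ ((Finset.Icc 1 N).disjSum {()}) (fun _ => (1 : ℝ))
    (Sum.elim (fun _ => (1 : ℝ)) fun _ => (Λ.card : ℝ)) (fun y s => Joined s x y)
    (Sum.elim (fun k s => k ≤ (clusterIn Λ s x).card) fun _ s => HasLargeCluster Λ N s)
    (fun s _ => by
      refine le_trans (le_of_eq ?_) ((key s).trans (le_of_eq ?_))
      · simp [clusterIn]
      · rw [Finset.sum_disjSum, Finset.sum_singleton]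
        simp only [Sum.elim_inl, Sum.elim_inr, one_mul]
        refine congrArg₂ (· + ·) (Finset.sum_congr rfl fun k _ => ?_) (congrArg _ ?_)
        · by_cases h : k ≤ (clusterIn Λ s x).card
          · exact (if_pos h).trans (if_pos h).symm
          · exact (if_neg h).trans (if_neg h).symm
        · by_cases h : HasLargeCluster Λ N s
          · exact (if_pos h).trans (if_pos h).symm
          · exact (if_neg h).trans (if_neg h).symm)
  simpa [Finset.sum_disjSum] using this

lemma Kernel.clusterTail_antitone (K : Kernel d) (β : ℝ≥0) : Antitone (K.clusterTail β) := by
  intro m n h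
  rw [Kernel.clusterTail, Kernel.clusterTail, K.percolation_eq]
  exact measureReal_mono fun ω (hω : (n : ℕ∞) ≤ (cluster ω 0).encard) =>
    (Nat.cast_le.2 h : (m : ℕ∞) ≤ n).trans hω

lemma Kernel.clusterTail_one (K : Kernel d) (β : ℝ≥0) : K.clusterTail β 1 = 1 := by
  have : {ω : Config d | ((1 : ℕ) : ℕ∞) ≤ (cluster ω 0).encard} = Set.univ := by
    ext ω
    simp only [Nat.cast_one, Set.mem_univ, iff_true]
    change 1 ≤ (cluster ω 0).encard
    rw [Set.one_le_encard_iff_nonempty]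
    exact ⟨0, SimpleGraph.Reachable.refl _⟩
  rw [Kernel.clusterTail, this, K.percolation_eq]
  exact probReal_univ

lemma Kernel.mul_clusterTail_le_sum (K : Kernel d) (β : ℝ≥0) (n : ℕ) :
    n * K.clusterTail β n ≤ ∑ k ∈ Finset.Icc 1 n, K.clusterTail β k := by
  have := Finset.card_nsmul_le_sum (Finset.Icc 1 n) (K.clusterTail β) (K.clusterTail β n)
    fun k hk => K.clusterTail_antitone β (Finset.mem_Icc.1 hk).2
  simpa using this

/-- Averaging the boundary flux over the position of the origin in `Λ`. -/
lemma Kernel.sum_boundaryFlux_le (K : Kernel d) (β : ℝ≥0) (Λ : Finset (Fin d → ℤ)) {M : ℝ}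
    (hM : ∀ x ∈ Λ, ∑ y ∈ Λ, prob (K.edgeProb β) Λ.sym2 (fun s => Joined s x y) ≤ M) :
    ∑ o ∈ Λ, K.boundaryFlux β Λ o ≤ M * (β * ∑ x ∈ Λ, K.outWeight Λ x) := by
  unfold Kernel.boundaryFlux
  rw [Finset.sum_comm, Finset.mul_sum, Finset.mul_sum]
  refine Finset.sum_le_sum fun u hu => ?_
  rw [← Finset.sum_mul]
  refine mul_le_mul_of_nonneg_right (le_trans (le_of_eq ?_) (hM u hu))
    (mul_nonneg β.2 (K.outWeight_nonneg Λ u))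
  refine Finset.sum_congr rfl fun o _ => ?_
  congr 1
  funext s
  exact propext ⟨SimpleGraph.Reachable.symm, SimpleGraph.Reachable.symm⟩

end ClusterSize

/-! ### Comparison of exponents -/

section Exponents

variable {d : ℕ}

lemma nonpos_of_rpow_natCast_le {a M : ℝ} (h : ∀ r : ℕ, 1 ≤ r → (r : ℝ) ^ a ≤ M) : a ≤ 0 := by
  by_contra ha
  push Not at ha
  have ht := (tendsto_rpow_atTop ha).comp tendsto_natCast_atTop_atTop (α := ℕ)
  obtain ⟨r, hr1, hr2⟩ := ((ht.eventually_gt_atTop M).and (Filter.eventually_ge_atTop 1)).exists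
  exact absurd (h r hr2) (not_le.2 hr1)

/-- The tail of the largest cluster in a box of side `r`: clusters of size at least a constant
times `r ^ κ`, where `κ (2 - e) = d + η`, have probability `O(r ^ (-d))`. -/
lemma Kernel.exists_prob_hasLargeCluster_le (K : Kernel d) (β : ℝ≥0) {C e η κ : ℝ} (hC : 0 ≤ C)
    (he1 : e ≤ 1) (hη : 0 < η) (hκ : κ * (2 - e) = d + η)
    (hdecay : ∀ n : ℕ, 1 ≤ n → ∑ k ∈ Finset.Icc 1 n, K.clusterTail β k ≤ C * (n : ℝ) ^ e) :
    ∃ k : ℕ, ∀ r : ℕ, 1 ≤ r →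
      prob (K.edgeProb β) (box d r).sym2 (HasLargeCluster (box d r) (3 ^ k * ⌈(r : ℝ) ^ κ⌉₊)) ≤
        C ^ 2 ^ k * (r : ℝ) ^ (-(d : ℝ)) := by
  obtain ⟨k, hk⟩ := pow_unbounded_of_one_lt ((d : ℝ) / η) (one_lt_two (α := ℝ))
  rw [div_lt_iff₀ hη] at hk
  refine ⟨k, fun r hr => ?_⟩
  have hr0 : (0 : ℝ) < r := by exact_mod_cast hr
  have hr1 : (1 : ℝ) ≤ r := by exact_mod_cast hr
  set n := ⌈(r : ℝ) ^ κ⌉₊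
  have hnκ : (r : ℝ) ^ κ ≤ n := Nat.le_ceil _
  have hn : 1 ≤ n := Nat.one_le_ceil_iff.2 (by positivity)
  have hn0 : (0 : ℝ) < n := by exact_mod_cast hn
  set a := prob (K.edgeProb β) (box d r).sym2 (HasLargeCluster (box d r) n)
  have h1 : n * a ≤ (r : ℝ) ^ d * K.clusterTail β n := by
    refine (mul_prob_hasLargeCluster_le _ _ _).trans ((Finset.sum_le_card_nsmul _ _ _ fun y _ =>
      K.prob_card_clusterIn_le β (box d r) y n).trans (le_of_eq ?_))
    rw [card_box, nsmul_eq_mul, Nat.cast_pow]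
  have h2 := (K.mul_clusterTail_le_sum β n).trans (hdecay n hn)
  have ha : a ≤ C * (r : ℝ) ^ (-η) := by
    have h3 : (n : ℝ) ^ 2 * a ≤ (r : ℝ) ^ d * (C * (n : ℝ) ^ e) := by
      calc (n : ℝ) ^ 2 * a = n * (n * a) := by ring
        _ ≤ n * ((r : ℝ) ^ d * K.clusterTail β n) := by gcongr
        _ = (r : ℝ) ^ d * (n * K.clusterTail β n) := by ring
        _ ≤ _ := by gcongr
    calc a = (n : ℝ) ^ (-2 : ℝ) * ((n : ℝ) ^ 2 * a) := by
          rw [← mul_assoc, Real.rpow_neg hn0.le, Real.rpow_two, inv_mul_cancel₀ (by positivity),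
            one_mul]
      _ ≤ (n : ℝ) ^ (-2 : ℝ) * ((r : ℝ) ^ d * (C * (n : ℝ) ^ e)) := by gcongr
      _ = C * (r : ℝ) ^ d * (n : ℝ) ^ (-2 + e) := by rw [Real.rpow_add hn0]; ring
      _ ≤ C * (r : ℝ) ^ d * ((r : ℝ) ^ κ) ^ (-2 + e) := by
          refine mul_le_mul_of_nonneg_left ?_ (by positivity)
          exact Real.rpow_le_rpow_of_nonpos (by positivity) hnκ (by linarith)
      _ = C * (r : ℝ) ^ (-η) := by
          rw [← Real.rpow_mul hr0.le, ← Real.rpow_natCast, mul_assoc, ← Real.rpow_add hr0]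
          congr 2
          linarith
  calc _ ≤ a ^ 2 ^ k := prob_hasLargeCluster_pow_le _ _ hn k
    _ ≤ (C * (r : ℝ) ^ (-η)) ^ 2 ^ k := pow_le_pow_left₀ (prob_nonneg _ _ _) ha _
    _ = C ^ 2 ^ k * (r : ℝ) ^ (-η * 2 ^ k) := by
        rw [mul_pow, ← Real.rpow_natCast ((r : ℝ) ^ (-η)), ← Real.rpow_mul hr0.le]
        push_cast
        rfl
    _ ≤ _ := by
        gcongr
        linarith

/-- The expected cluster size in a box of side `r` is `O(r ^ (κ e))`. -/
lemma Kernel.exists_sum_prob_joined_box_le (K : Kernel d) (β : ℝ≥0) {C e η κ : ℝ} (hC : 0 ≤ C)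
    (he0 : 0 ≤ e) (he1 : e ≤ 1) (hη : 0 < η) (hκ : κ * (2 - e) = d + η)
    (hdecay : ∀ n : ℕ, 1 ≤ n → ∑ k ∈ Finset.Icc 1 n, K.clusterTail β k ≤ C * (n : ℝ) ^ e) :
    ∃ D : ℝ, ∀ r : ℕ, 1 ≤ r → ∀ x ∈ box d r,
      ∑ y ∈ box d r, prob (K.edgeProb β) (box d r).sym2 (fun s => Joined s x y) ≤
        D * (r : ℝ) ^ (κ * e) := by
  obtain ⟨k, hk⟩ := K.exists_prob_hasLargeCluster_le β hC he1 hη hκ hdecay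
  have hκ0 : 0 ≤ κ := by
    by_contra h
    have : κ * (2 - e) ≤ 0 := mul_nonpos_of_nonpos_of_nonneg (by linarith) (by linarith)
    have : (0 : ℝ) ≤ d := by positivity
    linarith
  refine ⟨C * (3 ^ k * 2) ^ e + C ^ 2 ^ k, fun r hr x hx => ?_⟩
  have hr0 : (0 : ℝ) < r := by exact_mod_cast hr
  have hr1 : (1 : ℝ) ≤ r := by exact_mod_cast hr
  have hrκ : 1 ≤ (r : ℝ) ^ κ := Real.one_le_rpow hr1 hκ0
  have hceil : (⌈(r : ℝ) ^ κ⌉₊ : ℝ) ≤ 2 * (r : ℝ) ^ κ := by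
    have := Nat.ceil_lt_add_one (show (0 : ℝ) ≤ (r : ℝ) ^ κ by positivity)
    linarith
  have hn : 1 ≤ 3 ^ k * ⌈(r : ℝ) ^ κ⌉₊ :=
    Nat.mul_pos (by positivity) (Nat.one_le_ceil_iff.2 (by positivity))
  have hsum : ∑ j ∈ Finset.Icc 1 (3 ^ k * ⌈(r : ℝ) ^ κ⌉₊),
      prob (K.edgeProb β) (box d r).sym2 (fun s => j ≤ (clusterIn (box d r) s x).card) ≤
      C * (3 ^ k * 2) ^ e * (r : ℝ) ^ (κ * e) := by
    calc _ ≤ C * ((3 ^ k * ⌈(r : ℝ) ^ κ⌉₊ : ℕ) : ℝ) ^ e :=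
          (Finset.sum_le_sum fun j _ => K.prob_card_clusterIn_le β _ x j).trans (hdecay _ hn)
      _ ≤ C * ((3 ^ k * 2) * (r : ℝ) ^ κ) ^ e := by
          push_cast
          rw [mul_assoc ((3 : ℝ) ^ k)]
          gcongr
      _ = _ := by
          rw [Real.mul_rpow (by positivity) (by positivity), ← Real.rpow_mul hr0.le, mul_assoc]
  have hlarge : ((box d r).card : ℝ) * prob (K.edgeProb β) (box d r).sym2
      (HasLargeCluster (box d r) (3 ^ k * ⌈(r : ℝ) ^ κ⌉₊)) ≤ C ^ 2 ^ k * (r : ℝ) ^ (κ * e) := by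
    calc _ ≤ (r : ℝ) ^ (d : ℝ) * (C ^ 2 ^ k * (r : ℝ) ^ (-(d : ℝ))) := by
          rw [card_box, Nat.cast_pow, ← Real.rpow_natCast]
          exact mul_le_mul_of_nonneg_left (hk r hr) (by positivity)
      _ = C ^ 2 ^ k * 1 := by
          rw [mul_left_comm, ← Real.rpow_add hr0]; simp
      _ ≤ _ := by
          gcongr
          exact Real.one_le_rpow hr1 (mul_nonneg hκ0 he0)
  have := sum_prob_joined_le_truncated (K.edgeProb β) (box d r) hx (3 ^ k * ⌈(r : ℝ) ^ κ⌉₊)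
  linarith

/-- The inequality between the exponents of the boundary weight and of the truncated
susceptibility, up to an arbitrarily small loss `η`. -/
lemma Kernel.mul_le_of_decay (K : Kernel d) (hβc : K.criticalParameter < ⊤) {α θ C₁ C e η : ℝ}
    (hθ : 0 < θ) (hθ1 : θ ≤ 1) (hθα : θ < α)
    (hJ : ∀ x y : Fin d → ℤ, x ≠ y →
      (K.J x y : ℝ) ≤ C₁ * euclideanNorm (x - y) ^ (-(d : ℝ) - α))
    (hC : 0 ≤ C) (he0 : 0 ≤ e) (he1 : e ≤ 1) (hη : 0 < η)
    (hdecay : ∀ n : ℕ, 1 ≤ n → ∑ k ∈ Finset.Icc 1 n,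
      K.clusterTail K.criticalParameter.toNNReal k ≤ C * (n : ℝ) ^ e) :
    θ * (2 - e) ≤ (d + η) * e := by
  set β := K.criticalParameter.toNNReal
  have h2e : 0 < 2 - e := by linarith
  set κ := (d + η) / (2 - e) with hκd
  have hκ : κ * (2 - e) = d + η := div_mul_cancel₀ _ h2e.ne'
  obtain ⟨D, hD⟩ := K.exists_sum_prob_joined_box_le β hC he0 he1 hη hκ hdecay
  obtain ⟨C', hC'0, hC'⟩ := K.exists_sum_outWeight_box_le hθ hθ1 hθα hJ
  have hD0 : 0 ≤ D := by
    have h0 : (0 : Fin d → ℤ) ∈ box d 1 := by simp [box]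
    have h := (Finset.sum_nonneg fun y _ => prob_nonneg (K.edgeProb β) (box d 1).sym2
      (fun s => Joined s 0 y)).trans (hD 1 le_rfl 0 h0)
    simpa using h
  have hmain : ∀ r : ℕ, 1 ≤ r → (r : ℝ) ^ (θ - κ * e) ≤ D * (β * C') := by
    intro r hr
    have hr0 : (0 : ℝ) < r := by exact_mod_cast hr
    have h1 : (r : ℝ) ^ (d : ℝ) ≤ ∑ o ∈ box d r, K.boundaryFlux β (box d r) o := by
      have := Finset.card_nsmul_le_sum (box d r) (K.boundaryFlux β (box d r)) 1
        fun o ho => K.one_le_boundaryFlux hβc _ ho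
      rwa [card_box, nsmul_eq_mul, mul_one, Nat.cast_pow, ← Real.rpow_natCast] at this
    have h2 := h1.trans (K.sum_boundaryFlux_le β (box d r) (hD r hr))
    have h3 : (r : ℝ) ^ (d : ℝ) ≤
        D * (r : ℝ) ^ (κ * e) * (β * (C' * (r : ℝ) ^ ((d : ℝ) - θ))) := by
      refine h2.trans ?_
      gcongr
      exact hC' r hr
    calc (r : ℝ) ^ (θ - κ * e) = (r : ℝ) ^ (d : ℝ) * (r : ℝ) ^ (θ - κ * e - d) := by
          rw [← Real.rpow_add hr0]; congr 1; ring
      _ ≤ D * (r : ℝ) ^ (κ * e) * (β * (C' * (r : ℝ) ^ ((d : ℝ) - θ))) *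
          (r : ℝ) ^ (θ - κ * e - d) := by gcongr
      _ = D * (β * C') * ((r : ℝ) ^ (κ * e) * (r : ℝ) ^ ((d : ℝ) - θ) *
          (r : ℝ) ^ (θ - κ * e - d)) := by ring
      _ = D * (β * C') := by
          rw [← Real.rpow_add hr0, ← Real.rpow_add hr0]
          have : κ * e + ((d : ℝ) - θ) + (θ - κ * e - d) = 0 := by ring
          rw [this, Real.rpow_zero, mul_one]
  have h4 := nonpos_of_rpow_natCast_le hmain
  calc θ * (2 - e) ≤ κ * e * (2 - e) := mul_le_mul_of_nonneg_right (by linarith) h2e.le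
    _ = κ * (2 - e) * e := by ring
    _ = _ := by rw [hκ]

end Exponents

end LongRange

theorem mainTheorem4 (d : ℕ) (hd : 1 ≤ d) (α : ℝ) (hα : 0 < α) (hα1 : d = 1 → α < 1)
    (K : LongRange.Kernel d)
    (hJ : ∃ C₁ : ℝ, ∀ x y : Fin d → ℤ, x ≠ y →
      (K.J x y : ℝ) ≤ C₁ * LongRange.euclideanNorm (x - y) ^ (-(d : ℝ) - α))
    (hβc : K.criticalParameter < ⊤)
    (δ : ℝ) (hδ : 0 < δ)
    (hdecay : ∃ C : ℝ, ∀ n : ℕ, 1 ≤ n →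
      ∑ k ∈ Finset.Icc 1 n, K.clusterTail K.criticalParameter.toNNReal k
        ≤ C * (n : ℝ) ^ (1 - 1 / δ)) :
    ((d : ℝ) + min α 1) / ((d : ℝ) - min α 1) ≤ δ := by
  obtain ⟨C₁, hJ⟩ := hJ
  obtain ⟨C, hC⟩ := hdecay
  set e := 1 - 1 / δ with he
  have hone : ∀ n : ℕ, 1 ≤ n → 1 ≤ C * (n : ℝ) ^ e := fun n hn => by
    refine le_trans (le_of_eq (K.clusterTail_one K.criticalParameter.toNNReal).symm)
      (le_trans ?_ (hC n hn))
    exact Finset.single_le_sum (f := K.clusterTail K.criticalParameter.toNNReal)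
      (fun k _ => measureReal_nonneg) (Finset.mem_Icc.2 ⟨le_rfl, hn⟩)
  have hC0 : 0 ≤ C := by
    have := hone 1 le_rfl
    simp at this
    linarith
  -- The truncated susceptibility is at least one, so the exponent `e` cannot be negative.
  have he0 : 0 ≤ e := by
    have := LongRange.nonpos_of_rpow_natCast_le (a := -e) (M := C) fun r hr => by
      have hr0 : (0 : ℝ) < r := by exact_mod_cast hr
      rw [Real.rpow_neg hr0.le, inv_le_iff_one_le_mul₀ (by positivity)]
      exact hone r hr
    linarith
  have he1 : e ≤ 1 := by
    have : 0 ≤ 1 / δ := by positivity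
    linarith
  set m := min α 1
  have hm0 : 0 < m := lt_min hα one_pos
  have hθ : ∀ θ, 0 < θ → θ < m → θ * (2 - e) ≤ d * e := by
    intro θ h0 h1
    refine le_of_forall_pos_le_add fun η hη => ?_
    have := K.mul_le_of_decay hβc h0 (h1.le.trans (min_le_right _ _))
      (h1.trans_le (min_le_left _ _)) hJ hC0 he0 he1 hη hC
    nlinarith
  have hm : m * (2 - e) ≤ d * e := by
    have h2e : 0 < 2 - e := by linarith
    rw [← le_div_iff₀ h2e]
    refine le_of_forall_lt_imp_le_of_dense fun θ hθm => ?_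
    rcases le_or_gt θ 0 with h | h
    · exact h.trans (by positivity)
    · rw [le_div_iff₀ h2e]; exact hθ θ h hθm
  have hdm : 0 < (d : ℝ) - m := by
    rcases Nat.lt_or_ge 1 d with h | h
    · have h1 : (1 : ℝ) < d := by exact_mod_cast h
      have := min_le_right α 1
      linarith
    · have hd1 : d = 1 := le_antisymm h hd
      have h1 := min_le_left α 1
      have h2 := hα1 hd1
      rw [hd1, Nat.cast_one]
      linarith
  rw [div_le_iff₀ hdm]
  have hmul := mul_le_mul_of_nonneg_left hm hδ.le
  have hδe : δ * e = δ - 1 := by rw [he]; field_simp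
  nlinarith
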